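/- \textbf{Setting.} Let $\mathcal G$ be the vertex set of a finite simple graph, $\Lambda\subset\mathcal G$, and let $U_j,V_{ij},\kappa_m:\mathbb R\to\mathbb R$ ($j\in\mathcal G$, $i\sim j$, $m\in\Lambda$) be functions with $V_{ij}(x)=V_{ji}(-x)$. Consider $$\ddot q_j=-U_j'(q_j)+\sum_{i\sim j}V_{ij}'(q_i-q_j)+\delta_{j\Lambda}\int_{\mathbb R}\kappa_j(\nu)\xi_j(\nu,t)\,d\nu\quad(j\in\mathcal G),$$ $$\ddot\xi_m(\nu,t)=-\nu^2\xi_m(\nu,t)+\kappa_m(\nu)q_m(t)\quad(m\in\Lambda,\ \text{a.e. }\nu\in\mathbb R),$$ with initial data $(q,\xi,\dot q,\dot\xi)(0)=(q_0,\xi_0,\dot q_0,\dot\xi_0)$; here $\delta_{j\Lambda}=1$ if $j\in\Lambda$ and $0$ otherwise. Put $$K_m=\int_{\mathbb R}\frac{\kappa_m^2}{\nu^2}\,d\nu,\qquad V^{\rm eff}(q)=\sum_{j}U_j(q_j)+\frac12\sum_{(i,j):\,i\sim j}V_{ij}(q_i-q_j)-\sum_{m\in\Lambda}\frac{K_mq_m^2}{2},\qquad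 \varphi_m(t)=\int_{\mathbb R}\kappa_m(\nu)\xi_m(\nu,t)\,d\nu ,$$ where the middle sum in $V^{\rm eff}$ is over ordered pairs. \textbf{Assumptions.} (A1) All $U_j,V_{ij}$ are $C^\infty$, and each $V_{ij}''$ has only isolated zeros. (A2) There is an integer $r\ge0$ such that for each $m\in\Lambda$: $\kappa_m$ is $C^2$, $\kappa_m(\nu)=0$ if and only if $\nu=0$, $\kappa_m,\kappa_m''\in L^1\cap L^2$, and $\nu^r\kappa_m,\ |\nu|^{r/2}\kappa_m'\in L^2$. (A3) $V^{\rm eff}(q)\to+\infty$ as $|q|\to\infty$. (A4) For each $m\in\Lambda$, $\xi_{0m},\dot\xi_{0m}$ are measurable and $\frac12\int_{\mathbb R}(\dot\xi_{0m}^2+\nu^2\xi_{0m}^2)\,d\nu<\infty$. \textbf{Function spaces and singular support.} $\mathcal C_b$ is the space of bounded uniformly continuous functions on $\mathbb R$; $\mathcal C_0^{\pm}\subset\mathcal C_b$ consists of those that tend to $0$ at $\pm\infty$; $\mathcal C_0=\mathcal C_0^+\cap\mathcal C_0^-$. For a complex measure $\mu$ on $\mathbb R$ of finite total variation let $\hat\mu(\lambda)=\int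 e^{-i\lambda t}\mu(dt)$, and for $\phi\in\mathcal C_b$ let $(\phi*\mu)(t)=\int\phi(t-s)\,\mu(ds)$ (so that $\hat\mu\hat\phi$ is the Fourier transform of $\phi*\mu$). For $\star\in\{+,-\}$, $\lambda\in{\rm ssupp}^\star\hat\phi$ means that for every open interval $I\ni\lambda$ there is such a $\mu$ with ${\rm supp}\,\hat\mu\subset I$ and $\phi*\mu\notin\mathcal C_0^\star$; ${\rm ssupp}\,\hat\phi={\rm ssupp}^+\hat\phi\cup{\rm ssupp}^-\hat\phi$. \textbf{Proposition.} Assume (A1)--(A4), with $r$ as in (A2), and let $(q,\xi)$ be the solution, defined for all $t\in\mathbb R$, of the system with the given initial data. Then the integrals defining $K_m$ and $\varphi_m(t)$, $m\in\Lambda$, $t\in\mathbb R$, converge absolutely, and: 1. for every $m\in\Lambda$, $q_m\in\mathcal C_b$ and ${\rm ssupp}\,\hat q_m\subset\{0\}$; 2. for every $m\in\Lambda$ the function $\varphi_m$ is $C^{r+1}$ and $\varphi_m^{(k)}\in\mathcal C_b$ for $0\le k\le r+1$; for every $j\in\mathcal G$ the function $q_j$ is $C^{r+3}$ and $q_j^{(k)}\in\mathcal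 C_b$ for $0\le k\le r+3$; 3. for every $m\in\Lambda$ the function $\theta_m=\varphi_m-K_mq_m$ is $C^{r+1}$ and $\theta_m^{(k)}\in\mathcal C_0$ for $0\le k\le r+1$; in particular $\theta_m$ and its derivatives up to order $r+1$ tend to $0$ at $\pm\infty$. -/

import Mathlib

open MeasureTheory Filter Topology
open scoped ContDiff ENNReal

noncomputable section

/-! ## Function spaces on the line -/

/-- The space `C_b` of bounded uniformly continuous functions on the line. -/
def Cb (E : Type*) [NormedAddCommGroup E] : Set (ℝ → E) :=
  {f | UniformContinuous f ∧ ∃ C : ℝ, ∀ t, ‖f t‖ ≤ C}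

/-- The space `C₀⁺` of functions in `C_b` that tend to `0` at `+∞`. -/
def C0Plus (E : Type*) [NormedAddCommGroup E] : Set (ℝ → E) :=
  {f | f ∈ Cb E ∧ Tendsto f atTop (𝓝 0)}

/-- The space `C₀⁻` of functions in `C_b` that tend to `0` at `-∞`. -/
def C0Minus (E : Type*) [NormedAddCommGroup E] : Set (ℝ → E) :=
  {f | f ∈ Cb E ∧ Tendsto f atBot (𝓝 0)}

/-- The space `C₀ = C₀⁺ ∩ C₀⁻`. -/
def C0 (E : Type*) [NormedAddCommGroup E] : Set (ℝ → E) :=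
  C0Plus E ∩ C0Minus E

/-! ## Complex measures: integral, Fourier transform, convolution -/

/-- The integral `∫ f dμ` of a (bounded measurable) function against a complex measure, through
the Jordan decompositions of its real and imaginary parts: `μ = μ₁ - μ₂ + i μ₃ - i μ₄`. -/
def cmIntegral (μ : ComplexMeasure ℝ) (f : ℝ → ℂ) : ℂ :=
  ((∫ t, f t ∂(ComplexMeasure.re μ).toJordanDecomposition.posPart) -
      ∫ t, f t ∂(ComplexMeasure.re μ).toJordanDecomposition.negPart) +
    Complex.I * ((∫ t, f t ∂(ComplexMeasure.im μ).toJordanDecomposition.posPart) -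
      ∫ t, f t ∂(ComplexMeasure.im μ).toJordanDecomposition.negPart)

/-- The Fourier transform `μ̂(l) = ∫ exp(-i l t) μ(dt)`. -/
def cmFourier (μ : ComplexMeasure ℝ) (l : ℝ) : ℂ :=
  cmIntegral μ (fun t => Complex.exp (-(Complex.I * l * t)))

/-- The convolution `(φ * μ)(t) = ∫ φ(t - s) μ(ds)`.  For `φ ∈ C_b`, the product `μ̂ φ̂` is by
definition the Fourier transform of this function. -/
def cmConv (φ : ℝ → ℂ) (μ : ComplexMeasure ℝ) (t : ℝ) : ℂ :=
  cmIntegral μ (fun s => φ (t - s))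

/-! ## Singular support of the Fourier transform of a function in `C_b` -/

/-- `ssupp⁺ φ̂`: for every open interval `I ∋ l` there is a complex measure `μ` with
`supp μ̂ ⊆ I` such that `φ * μ ∉ C₀⁺`, that is, `μ̂ φ̂` is not in the Fourier image of `C₀⁺`. -/
def ssuppPlus (φ : ℝ → ℂ) : Set ℝ :=
  {l | ∀ a b : ℝ, l ∈ Set.Ioo a b →
    ∃ μ : ComplexMeasure ℝ, tsupport (cmFourier μ) ⊆ Set.Ioo a b ∧ cmConv φ μ ∉ C0Plus ℂ}

/-- `ssupp⁻ φ̂`, the same with `C₀⁻`. -/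
def ssuppMinus (φ : ℝ → ℂ) : Set ℝ :=
  {l | ∀ a b : ℝ, l ∈ Set.Ioo a b →
    ∃ μ : ComplexMeasure ℝ, tsupport (cmFourier μ) ⊆ Set.Ioo a b ∧ cmConv φ μ ∉ C0Minus ℂ}

/-- The singular support `ssupp φ̂` of the Fourier transform of `φ ∈ C_b`. -/
def ssuppHat (φ : ℝ → ℂ) : Set ℝ :=
  ssuppPlus φ ∪ ssuppMinus φ

/-! ## The network of oscillators and thermostats -/

/-- A finite network: the graph, the set `Λ` of vertices coupled to thermostats, the pinning
potentials `U j`, the interaction potentials `V i j` (only the values at adjacent vertices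
matter) and the coupling functions `κ m` (only the values at `m ∈ Λ` matter). -/
structure OscNetwork (G : Type*) where
  graph : SimpleGraph G
  Λ : Finset G
  U : G → ℝ → ℝ
  V : G → G → ℝ → ℝ
  κ : G → ℝ → ℝ
  V_symm : ∀ i j, graph.Adj i j → ∀ x, V i j x = V j i (-x)

/-- The energy of a thermostat, `½ ∫ (ξ̇² + ν² ξ²) dν`. -/
def thermostatEnergy (ξ ξ' : ℝ → ℝ) : ℝ≥0∞ :=
  ∫⁻ ν : ℝ, ENNReal.ofReal ((ξ' ν ^ 2 + ν ^ 2 * ξ ν ^ 2) / 2)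

namespace OscNetwork

variable {G : Type*} [Fintype G] (S : OscNetwork G)

/-- `K_m = ∫ κ_m² / ν² dν`. -/
def K (m : G) : ℝ := ∫ ν : ℝ, S.κ m ν ^ 2 / ν ^ 2

open Classical in
/-- The effective potential
`V_eff(q) = ∑_j U_j(q_j) + ½ ∑_{i ~ j} V_ij(q_i - q_j) - ∑_{m ∈ Λ} K_m q_m² / 2`,
the middle sum being over ordered pairs of adjacent vertices. -/
def Veff (q : G → ℝ) : ℝ :=
  (∑ j, S.U j (q j))
    + (1 / 2) * (∑ i, ∑ j ∈ Finset.univ.filter (fun j => S.graph.Adj i j), S.V i j (q i - q j))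
    - ∑ m ∈ S.Λ, S.K m * q m ^ 2 / 2

/-- The force `φ_m(t) = ∫ κ_m(ν) ξ_m(ν, t) dν` exerted by a thermostat; `ξ m ν t` is the
coordinate at time `t` of the thermostat oscillator with frequency `ν`. -/
def force (ξ : G → ℝ → ℝ → ℝ) (m : G) (t : ℝ) : ℝ :=
  ∫ ν : ℝ, S.κ m ν * ξ m ν t

/-- The potentials are smooth, and the second derivatives `V_ij''` have only isolated zeros. -/
def A1 : Prop :=
  (∀ j, ContDiff ℝ ∞ (S.U j)) ∧
  (∀ i j, S.graph.Adj i j → ContDiff ℝ ∞ (S.V i j) ∧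
    ∀ x, deriv (deriv (S.V i j)) x = 0 → ∀ᶠ y in 𝓝[≠] x, deriv (deriv (S.V i j)) y ≠ 0)

/-- For `m ∈ Λ`: `κ_m` is `C²`, vanishes exactly at `0`, `κ_m, κ_m'' ∈ L¹ ∩ L²`, and
`ν^r κ_m, |ν|^(r/2) κ_m' ∈ L²`. -/
def A2 (r : ℕ) : Prop :=
  ∀ m ∈ S.Λ, ContDiff ℝ 2 (S.κ m) ∧ (∀ ν, S.κ m ν = 0 ↔ ν = 0) ∧
    MemLp (S.κ m) 1 volume ∧ MemLp (S.κ m) 2 volume ∧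
    MemLp (deriv (deriv (S.κ m))) 1 volume ∧ MemLp (deriv (deriv (S.κ m))) 2 volume ∧
    MemLp (fun ν => ν ^ r * S.κ m ν) 2 volume ∧
    MemLp (fun ν => |ν| ^ ((r : ℝ) / 2) * deriv (S.κ m) ν) 2 volume

/-- `V_eff(q) → +∞` as `|q| → ∞`. -/
def A3 : Prop := Tendsto S.Veff (cocompact (G → ℝ)) atTop

/-- The initial data of the thermostats are measurable and have finite energy. -/
def A4 (ξ₀ ξ₀' : G → ℝ → ℝ) : Prop :=
  ∀ m ∈ S.Λ, AEMeasurable (ξ₀ m) ∧ AEMeasurable (ξ₀' m) ∧ thermostatEnergy (ξ₀ m) (ξ₀' m) < ⊤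

open Classical in
/-- `(q, ξ)` is a solution, on the whole time axis, of the equations of motion
`q̈_j = -U_j'(q_j) + ∑_{i ~ j} V_ij'(q_i - q_j) + δ_{jΛ} ∫ κ_j ξ_j dν`,
`ξ̈_m(ν) = -ν² ξ_m(ν) + κ_m(ν) q_m` for `m ∈ Λ` and almost every `ν`,
with the initial data `(q, ξ, q̇, ξ̇)(0) = (q₀, ξ₀, q₀', ξ₀')`. -/
structure IsSolution (q₀ : G → ℝ) (ξ₀ : G → ℝ → ℝ) (q₀' : G → ℝ) (ξ₀' : G → ℝ → ℝ)
    (q : G → ℝ → ℝ) (ξ : G → ℝ → ℝ → ℝ) : Prop where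
  differentiable_q : ∀ j, Differentiable ℝ (q j)
  eq_q : ∀ j t, HasDerivAt (deriv (q j))
    (-deriv (S.U j) (q j t)
      + (∑ i ∈ Finset.univ.filter (fun i => S.graph.Adj i j),
          deriv (S.V i j) (q i t - q j t))
      + (if j ∈ S.Λ then S.force ξ j t else 0)) t
  differentiable_ξ : ∀ m ∈ S.Λ, ∀ᵐ ν : ℝ, Differentiable ℝ (ξ m ν)
  eq_ξ : ∀ m ∈ S.Λ, ∀ᵐ ν : ℝ, ∀ t,
    HasDerivAt (deriv (ξ m ν)) (-ν ^ 2 * ξ m ν t + S.κ m ν * q m t) t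
  init_q : ∀ j, q j 0 = q₀ j
  init_q' : ∀ j, deriv (q j) 0 = q₀' j
  init_ξ : ∀ m ∈ S.Λ, ∀ᵐ ν : ℝ, ξ m ν 0 = ξ₀ m ν
  init_ξ' : ∀ m ∈ S.Λ, ∀ᵐ ν : ℝ, deriv (ξ m ν) 0 = ξ₀' m ν

end OscNetwork

end

noncomputable section

/-! Write `a = κ/ν` for the quotient extended continuously to `0`, and `v = q̇`. For each thermostat
the complex amplitude `w = ξ̇ + i(νξ - a q)`, measured from the instantaneous equilibrium `ξ = κ
q/ν²`, solves `∂ₜw = iνw - i a v`. Then `θ = φ - K q` is `Im ∫ a w dν`, and `∑ q̇²/2 + V_eff(q) + ½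
∑ ‖w‖²` is conserved (`IsSolution.totalEnergy_eq`). Since `V_eff` is continuous and coercive, `q`,
`q̇` and `‖w‖` in `L²(dν)` are bounded for all times (`IsSolution.exists_bounds`).

The heart of the proof is that `v → 0` at both ends for each vertex of `Λ`
(`AmpData.tendsto_velocity`). In the rotating frame, `a(ν) ∫_{-n}^{n} e^{-iνs} v(s) ds` is, up to a
factor of modulus one, the difference of the amplitudes at `n` and `-n`, hence bounded in `L²`
uniformly in `n`. As `a` has no zero except `0`, Plancherel and Fatou put every band-pass filtering
of `v` away from frequency `0` in `L²` (`AmpData.tendsto_smoothing`); being Lipschitz, it tends to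
`0`. The remaining high frequencies are uniformly small because `v` is Lipschitz, and the low ones
because `v` is the derivative of the bounded function `q`.

Consequently `q(t - s) - q(t) → 0` for each `s`. For such a function `φ * μ` is asymptotic to `μ̂(0)
φ`, so nothing singular survives off frequency `0` (`ssuppHat_subset_zero`).

By Duhamel, `∫ a w` is a Fourier integral of the integrable function `a w₀`, which decays by
Riemann–Lebesgue, plus a convolution of `v` with `Z(t) = ∫ e^{iνt} a² dν`. The assumptions on `κ''`
make `Z` integrable (`integrable_oscInt_quot_sq`), so the convolution, and with it `θ`, tends to
`0`.

Regularity is a bootstrap (`IsSolution.cbReg`): a time derivative of `∫ ν^i a w` raises the moment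
`i` by one and releases a multiple of `v`, while Newton's equation returns two derivatives of `q`
for each order of `θ`. The moments last up to `ν^(r+1) a = ν^r κ ∈ L²`. Finally, decay passes from a
function to its uniformly continuous derivative (`tendsto_deriv_zero`). -/

theorem eLpNorm_two_sq {E : Type*} [NormedAddCommGroup E] (f : ℝ → E) :
    eLpNorm f 2 volume ^ 2 = ∫⁻ x, ‖f x‖ₑ ^ 2 := by
  rw [eLpNorm_eq_lintegral_rpow_enorm_toReal (by norm_num) (by norm_num), ← ENNReal.rpow_natCast,
    ← ENNReal.rpow_mul]
  norm_num

open FourierTransform in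
/-- Plancherel's theorem for integrable square integrable functions on the line. -/
theorem eLpNorm_fourier_of_integrable {f : ℝ → ℂ} (h1 : Integrable f) (h2 : MemLp f 2 volume) :
    eLpNorm (𝓕 f) 2 volume = eLpNorm f 2 volume := by
  set F : Lp ℂ 2 (volume : Measure ℝ) := h2.toLp f with hF
  -- The `L²` Fourier transform agrees with the integral one because both pair equally with test
  -- functions: the transform is moved onto the test function on either side.
  have key : (𝓕 F : Lp ℂ 2 (volume : Measure ℝ)) =ᵐ[volume] 𝓕 f := by
    have hcont : Continuous (𝓕 f) :=
      VectorFourier.fourierIntegral_continuous Real.continuous_fourierChar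
        (by exact continuous_inner) h1
    refine ae_eq_of_integral_contDiff_smul_eq
      ((Lp.memLp (𝓕 F)).locallyIntegrable (by norm_num)) hcont.locallyIntegrable ?_
    intro g hg hgs
    have hg' : ContDiff ℝ ∞ (fun x => (g x : ℂ)) := Complex.ofRealCLM.contDiff.comp hg
    have hgs' : HasCompactSupport (fun x => (g x : ℂ)) :=
      hgs.comp_left (g := fun x : ℝ => (x : ℂ)) Complex.ofReal_zero
    let G : SchwartzMap ℝ ℂ := hgs'.toSchwartzMap hg'
    have hG : ∀ x, G x = (g x : ℂ) := fun x => rfl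
    have e1 := congrArg (fun T => T G) (Lp.fourier_toTemperedDistribution_eq F)
    simp only [TemperedDistribution.fourier_apply, Lp.toTemperedDistribution_apply] at e1
    have e2 : ∫ x, (𝓕 G) x • F x = ∫ x, G x • (𝓕 f) x := by
      rw [integral_congr_ae (g := fun x => (𝓕 G) x • f x)]
      · exact (VectorFourier.integral_fourierIntegral_smul_eq_flip (L := innerₗ ℝ)
          Real.continuous_fourierChar continuous_inner G.integrable h1).trans
            (by simp only [flip_innerₗ]; rfl)
      · filter_upwards [h2.coeFn_toLp] with x hx
        rw [hF, hx]
    rw [e2] at e1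
    simpa [hG] using e1.symm
  rw [← eLpNorm_congr_ae key, ← eLpNorm_congr_ae h2.coeFn_toLp]
  have := Lp.norm_fourier_eq F
  rw [Lp.norm_def, Lp.norm_def] at this
  exact (ENNReal.toReal_eq_toReal_iff' (Lp.eLpNorm_ne_top _) (Lp.eLpNorm_ne_top _)).1 this

/-- The oscillatory integral `t ↦ ∫ exp(i ν t) f(ν) dν`. -/
def oscInt (f : ℝ → ℂ) (t : ℝ) : ℂ := ∫ ν : ℝ, Complex.exp (Complex.I * ν * t) * f ν

open FourierTransform in
theorem oscInt_eq_fourier (f : ℝ → ℂ) (t : ℝ) :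
    oscInt f t = 𝓕 f ((-(2 * Real.pi))⁻¹ * t) := by
  rw [Real.fourier_real_eq_integral_exp_smul, oscInt]
  congr 1
  ext ν
  rw [smul_eq_mul]
  congr 2
  have : (Real.pi : ℂ) ≠ 0 := by exact_mod_cast Real.pi_ne_zero
  push_cast
  field_simp

theorem continuous_oscInt {f : ℝ → ℂ} (h1 : Integrable f) : Continuous (oscInt f) := by
  have hcont : Continuous (FourierTransform.fourier f) :=
      VectorFourier.fourierIntegral_continuous Real.continuous_fourierChar
        (by exact continuous_inner) h1
  rw [funext (oscInt_eq_fourier f)]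
  exact hcont.comp (continuous_const.mul continuous_id)

theorem tendsto_oscInt_cocompact (f : ℝ → ℂ) : Tendsto (oscInt f) (cocompact ℝ) (𝓝 0) := by
  rw [funext (oscInt_eq_fourier f)]
  refine (Real.zero_at_infty_fourier f).comp ?_
  exact (Homeomorph.mulLeft₀ ((-(2 * Real.pi))⁻¹)
    (inv_ne_zero (neg_ne_zero.2 (by positivity)))).isClosedEmbedding.tendsto_cocompact

theorem lintegral_enorm_oscInt_sq {f : ℝ → ℂ} (h1 : Integrable f) (h2 : MemLp f 2 volume) :
    ∫⁻ t, ‖oscInt f t‖ₑ ^ 2 = ENNReal.ofReal (2 * Real.pi) * ∫⁻ ν, ‖f ν‖ₑ ^ 2 := by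
  have hcont : Continuous (FourierTransform.fourier f) :=
      VectorFourier.fourierIntegral_continuous Real.continuous_fourierChar
        (by exact continuous_inner) h1
  have hP := eLpNorm_fourier_of_integrable h1 h2
  have hP' : ∫⁻ t, ‖FourierTransform.fourier f t‖ₑ ^ 2 = ∫⁻ ν, ‖f ν‖ₑ ^ 2 := by
    rw [← eLpNorm_two_sq, ← eLpNorm_two_sq, hP]
  rw [← hP', funext (oscInt_eq_fourier f)]
  have hm := Real.map_volume_mul_left (a := (-(2 * Real.pi))⁻¹)
    (inv_ne_zero (neg_ne_zero.2 (by positivity)))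
  have := lintegral_map (μ := volume) (f := fun t => ‖FourierTransform.fourier f t‖ₑ ^ 2)
    (g := fun t => (-(2 * Real.pi))⁻¹ * t) (by fun_prop) (by fun_prop)
  rw [← this, hm, lintegral_smul_measure]
  congr 2
  rw [inv_inv, abs_neg, abs_of_pos (by positivity)]

theorem oscInt_deriv {b : ℝ → ℂ} (hb : Differentiable ℝ b) (h1 : Integrable b)
    (h1' : Integrable (deriv b)) (t : ℝ) :
    oscInt (deriv b) t = -(Complex.I * t) * oscInt b t := by
  rw [oscInt_eq_fourier, oscInt_eq_fourier, Real.fourier_deriv h1 hb h1']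
  simp only [smul_eq_mul]
  congr 1
  have : (Real.pi : ℂ) ≠ 0 := by exact_mod_cast Real.pi_ne_zero
  push_cast
  field_simp

theorem memLp_two_oscInt {f : ℝ → ℂ} (h1 : Integrable f) (h2 : MemLp f 2 volume) :
    MemLp (oscInt f) 2 volume := by
  refine ⟨(continuous_oscInt h1).aestronglyMeasurable, ?_⟩
  have h3 := h2.2
  have : eLpNorm (oscInt f) 2 volume ^ 2 < ⊤ := by
    rw [eLpNorm_two_sq, lintegral_enorm_oscInt_sq h1 h2, ← eLpNorm_two_sq]
    exact ENNReal.mul_lt_top ENNReal.ofReal_lt_top (ENNReal.pow_lt_top h3)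
  simpa using this

/-- The transform of `b'` is `-it` times that of `b`, so `(1 + |t|) |oscInt b|` lies in `L²` by
Plancherel. The weight `(1 + |t|)⁻¹` also lies in `L²`, and Cauchy–Schwarz concludes. -/
theorem integrable_oscInt {b : ℝ → ℂ} (hb : Differentiable ℝ b) (h1 : Integrable b)
    (h2 : MemLp b 2 volume) (h1' : Integrable (deriv b)) (h2' : MemLp (deriv b) 2 volume) :
    Integrable (oscInt b) := by
  have m1 := (memLp_two_oscInt h1 h2).norm
  have m2 := (memLp_two_oscInt h1' h2').norm
  have m3 : MemLp (fun t : ℝ => (1 + |t|)⁻¹) 2 volume := by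
    have hc : Continuous (fun t : ℝ => (1 + |t|)⁻¹) :=
      Continuous.inv₀ (by fun_prop) (fun t => by positivity)
    rw [memLp_two_iff_integrable_sq hc.aestronglyMeasurable]
    refine integrable_inv_one_add_sq.mono' (hc.pow 2).aestronglyMeasurable (ae_of_all _ fun t => ?_)
    rw [Real.norm_of_nonneg (by positivity), inv_pow]
    refine inv_anti₀ (by positivity) ?_
    nlinarith [abs_nonneg t, sq_abs t]
  refine (m3.integrable_mul (m1.add m2)).mono' (continuous_oscInt h1).aestronglyMeasurable
    (ae_of_all _ fun t => ?_)
  simp only [Pi.mul_apply, Pi.add_apply, oscInt_deriv hb h1 h1', norm_mul, norm_neg, Complex.norm_I,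
    one_mul, Complex.norm_real, Real.norm_eq_abs]
  have : 0 < 1 + |t| := by positivity
  rw [← one_add_mul, inv_mul_cancel_left₀ this.ne']

theorem memLp_two_of_bounded {f : ℝ → ℂ} (hf : Integrable f) {C : ℝ} (hC : ∀ x, ‖f x‖ ≤ C) :
    MemLp f 2 volume := by
  rw [memLp_two_iff_integrable_sq_norm hf.1]
  refine (hf.norm.const_mul C).mono' (hf.1.norm.pow 2) (ae_of_all _ fun x => ?_)
  rw [Real.norm_of_nonneg (by positivity), sq]
  exact mul_le_mul_of_nonneg_right (hC x) (norm_nonneg _)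

/-! ### The quotient `κ(ν)/ν` -/

/-- The continuous extension of `κ(ν)/ν`, for a `C¹` function with `κ(0) = 0`. -/
def quot (κ : ℝ → ℝ) (ν : ℝ) : ℝ := ∫ s in (0 : ℝ)..1, deriv κ (s * ν)

theorem mul_quot {κ : ℝ → ℝ} (hκ : ContDiff ℝ 2 κ) (h0 : κ 0 = 0) (ν : ℝ) :
    ν * quot κ ν = κ ν := by
  have hd : Continuous (deriv κ) := hκ.continuous_deriv (by norm_num)
  rw [quot, intervalIntegral.mul_integral_comp_mul_right, zero_mul, one_mul,
    intervalIntegral.integral_deriv_eq_sub'  κ rfl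
      (fun x _ => hκ.differentiable (by norm_num) x) hd.continuousOn, h0, sub_zero]

theorem quot_eq_div {κ : ℝ → ℝ} (hκ : ContDiff ℝ 2 κ) (h0 : κ 0 = 0) {ν : ℝ} (hν : ν ≠ 0) :
    quot κ ν = κ ν / ν := by
  rw [← mul_quot hκ h0 ν, mul_div_cancel_left₀ _ hν]

theorem ContDiff.deriv_deriv_continuous {κ : ℝ → ℝ} (hκ : ContDiff ℝ 2 κ) :
    ContDiff ℝ 1 (deriv κ) ∧ Continuous (deriv (deriv κ)) := by
  have h : ContDiff ℝ 1 (deriv κ) :=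
    ((contDiff_succ_iff_deriv (n := 1) (f := κ)).1 (by simpa using! hκ)).2.2
  exact ⟨h, h.continuous_deriv le_rfl⟩

theorem hasDerivAt_quot {κ : ℝ → ℝ} (hκ : ContDiff ℝ 2 κ) (ν : ℝ) :
    HasDerivAt (quot κ) (∫ s in (0 : ℝ)..1, s * deriv (deriv κ) (s * ν)) ν := by
  obtain ⟨h1, h2⟩ := hκ.deriv_deriv_continuous
  obtain ⟨C, hC⟩ := (isCompact_closedBall (0 : ℝ) (|ν| + 1)).exists_bound_of_continuousOn
    h2.continuousOn
  have hd := h1.continuous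
  refine (intervalIntegral.hasDerivAt_integral_of_dominated_loc_of_deriv_le
    (F := fun x s => deriv κ (s * x)) (F' := fun x s => s * deriv (deriv κ) (s * x))
    (bound := fun _ => C) (Metric.ball_mem_nhds ν one_pos) (Eventually.of_forall fun x => ?_) ?_ ?_
    (ae_of_all _ fun s hs x hx => ?_) intervalIntegrable_const
    (ae_of_all _ fun s hs x hx => ?_)).2
  · exact (hd.comp (continuous_id.mul continuous_const)).aestronglyMeasurable
  · exact (hd.comp (continuous_id.mul continuous_const)).intervalIntegrable _ _
  · exact (continuous_id.mul (h2.comp (continuous_id.mul continuous_const))).aestronglyMeasurable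
  · rw [Set.uIoc_of_le zero_le_one] at hs
    have hx' : |x| ≤ |ν| + 1 := by
      have := mem_ball_iff_norm.1 hx
      rw [Real.norm_eq_abs] at this
      have := abs_sub_abs_le_abs_sub x ν
      linarith
    have : ‖deriv (deriv κ) (s * x)‖ ≤ C := by
      refine hC _ ?_
      rw [mem_closedBall_zero_iff, norm_mul, Real.norm_of_nonneg hs.1.le, Real.norm_eq_abs]
      exact (mul_le_of_le_one_left (abs_nonneg _) hs.2).trans hx'
    rw [norm_mul, Real.norm_of_nonneg hs.1.le]
    exact (mul_le_of_le_one_left (norm_nonneg _) hs.2).trans this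
  · have := (h1.differentiable one_ne_zero (s * x)).hasDerivAt.comp x
      ((hasDerivAt_id x).const_mul s)
    simpa [mul_comm] using! this

theorem continuous_quot {κ : ℝ → ℝ} (hκ : ContDiff ℝ 2 κ) : Continuous (quot κ) :=
  continuous_iff_continuousAt.2 fun ν => (hasDerivAt_quot hκ ν).continuousAt

theorem continuous_deriv_quot {κ : ℝ → ℝ} (hκ : ContDiff ℝ 2 κ) : Continuous (deriv (quot κ)) := by
  obtain ⟨h1, h2⟩ := hκ.deriv_deriv_continuous
  rw [funext fun ν => (hasDerivAt_quot hκ ν).deriv]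
  refine intervalIntegral.continuous_parametric_intervalIntegral_of_continuous' ?_ 0 1
  exact continuous_snd.mul (h2.comp (continuous_snd.mul continuous_fst))

theorem exists_bound_deriv {κ : ℝ → ℝ} (hκ : ContDiff ℝ 2 κ)
    (h : Integrable (deriv (deriv κ))) : ∃ L, ∀ ν, |deriv κ ν| ≤ L := by
  obtain ⟨h1, h2⟩ := hκ.deriv_deriv_continuous
  refine ⟨|deriv κ 0| + ∫ ν, ‖deriv (deriv κ) ν‖, fun ν => ?_⟩
  have e : deriv κ ν = deriv κ 0 + ∫ x in (0 : ℝ)..ν, deriv (deriv κ) x := by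
    rw [intervalIntegral.integral_deriv_eq_sub' (deriv κ) rfl
      (fun x _ => h1.differentiable one_ne_zero x) h2.continuousOn]
    ring
  rw [e]
  refine (abs_add_le _ _).trans (add_le_add_right ?_ _)
  refine (intervalIntegral.norm_integral_le_integral_norm_uIoc
    (f := deriv (deriv κ)) (a := 0) (b := ν) (μ := volume)).trans ?_
  exact setIntegral_le_integral h.norm (ae_of_all _ fun x => norm_nonneg _)

/-- The product rule for `κ = ν a` gives `ν a' = κ' - a`, where both terms are bounded by `sup
|κ'|`; this controls `a'` for `|ν| ≥ 1`, and compactness does so for `|ν| ≤ 1`. -/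
theorem exists_bound_quot {κ : ℝ → ℝ} (hκ : ContDiff ℝ 2 κ) (h0 : κ 0 = 0)
    (h : Integrable (deriv (deriv κ))) :
    ∃ L, 0 ≤ L ∧ (∀ ν, |quot κ ν| ≤ L) ∧ (∀ ν, |deriv (quot κ) ν| ≤ L) ∧
      ∀ ν, 1 ≤ |ν| → |ν| * |deriv (quot κ) ν| ≤ L := by
  obtain ⟨L, hL⟩ := exists_bound_deriv hκ h
  obtain ⟨C, hC⟩ := (isCompact_closedBall (0 : ℝ) 1).exists_bound_of_continuousOn
    (continuous_deriv_quot hκ).continuousOn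
  have hL0 : 0 ≤ L := (abs_nonneg _).trans (hL 0)
  have hq : ∀ ν, |quot κ ν| ≤ L := fun ν => by
    have := intervalIntegral.norm_integral_le_of_norm_le_const (a := 0) (b := 1)
      (f := fun s => deriv κ (s * ν)) (C := L) fun s _ => hL _
    simpa [quot] using this
  have hq' : ∀ ν, 1 ≤ |ν| → |ν| * |deriv (quot κ) ν| ≤ 2 * L := fun ν hν => by
    have e : quot κ ν + ν * deriv (quot κ) ν = deriv κ ν := by
      have h1 := (hasDerivAt_id ν).mul (hasDerivAt_quot hκ ν).differentiableAt.hasDerivAt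
      have h2 : HasDerivAt κ _ ν := h1.congr_of_eventuallyEq
        (Eventually.of_forall fun x => (mul_quot hκ h0 x).symm)
      simpa using h2.deriv.symm
    rw [← abs_mul, ← add_sub_cancel_left (quot κ ν) (ν * _), e]
    have := abs_sub (deriv κ ν) (quot κ ν)
    linarith [hq ν, hL ν]
  refine ⟨2 * L + |C|, by positivity, fun ν => ?_, fun ν => ?_, fun ν hν => ?_⟩
  · linarith [hq ν, abs_nonneg C]
  · rcases le_total |ν| 1 with h | h
    · have := hC ν (by simpa using h)
      rw [Real.norm_eq_abs] at this
      linarith [le_abs_self C]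
    · have := hq' ν h
      have := le_mul_of_one_le_left (abs_nonneg (deriv (quot κ) ν)) h
      linarith [abs_nonneg C]
  · linarith [hq' ν hν, abs_nonneg C]

/-- The quotient is bounded near the origin, and dominated by `κ` where `|ν| ≥ 1`. -/
theorem memLp_two_quot {κ : ℝ → ℝ} (hκ : ContDiff ℝ 2 κ) (h0 : κ 0 = 0)
    (h : Integrable (deriv (deriv κ))) (h2 : MemLp κ 2 volume) : MemLp (quot κ) 2 volume := by
  obtain ⟨L, hL0, hL, -, -⟩ := exists_bound_quot hκ h0 h
  have hc := continuous_quot hκ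
  rw [memLp_two_iff_integrable_sq hc.aestronglyMeasurable]
  refine ((integrable_inv_one_add_sq.const_mul (2 * L ^ 2)).add h2.integrable_sq).mono'
    (hc.pow 2).aestronglyMeasurable (ae_of_all _ fun ν => ?_)
  rw [Real.norm_of_nonneg (by positivity)]
  simp only [Pi.add_apply]
  rcases le_total (ν ^ 2) 1 with h | h
  · have h3 : quot κ ν ^ 2 ≤ L ^ 2 := sq_le_sq' (abs_le.1 (hL ν)).1 (abs_le.1 (hL ν)).2
    have : L ^ 2 ≤ 2 * L ^ 2 * (1 + ν ^ 2)⁻¹ := by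
      rw [← div_eq_mul_inv, le_div_iff₀ (by positivity)]
      nlinarith [sq_nonneg L]
    nlinarith [sq_nonneg (κ ν)]
  · rw [← mul_quot hκ h0 ν, mul_pow]
    have : 0 ≤ 2 * L ^ 2 * (1 + ν ^ 2)⁻¹ := by positivity
    nlinarith [sq_nonneg (quot κ ν)]

/-- The correlation function of a thermostat is integrable. -/
theorem integrable_oscInt_quot_sq {κ : ℝ → ℝ} (hκ : ContDiff ℝ 2 κ) (h0 : κ 0 = 0)
    (h : Integrable (deriv (deriv κ))) (h2 : MemLp κ 2 volume) :
    Integrable (oscInt fun ν => ((quot κ ν ^ 2 : ℝ) : ℂ)) := by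
  obtain ⟨L, hL0, hL, hL', hL''⟩ := exists_bound_quot hκ h0 h
  have hc := continuous_quot hκ
  have hc' := continuous_deriv_quot hκ
  have hsq : Integrable (fun ν => quot κ ν ^ 2) := (memLp_two_quot hκ h0 h h2).integrable_sq
  have hd : ∀ ν, HasDerivAt (fun ν => ((quot κ ν ^ 2 : ℝ) : ℂ))
      ((2 * quot κ ν * deriv (quot κ) ν : ℝ) : ℂ) ν := fun ν => by
    have := ((hasDerivAt_quot hκ ν).differentiableAt.hasDerivAt.pow 2).ofReal_comp
    simpa using this
  have hi : Integrable (fun ν => ((quot κ ν ^ 2 : ℝ) : ℂ)) := hsq.ofReal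
  have hi' : Integrable (deriv fun ν => ((quot κ ν ^ 2 : ℝ) : ℂ)) := by
    rw [funext fun ν => (hd ν).deriv]
    refine Integrable.ofReal (f := fun ν => 2 * quot κ ν * deriv (quot κ) ν) ?_
    refine ((integrable_inv_one_add_sq.const_mul (4 * L ^ 2 + 2 * L)).add
      (hsq.const_mul L)).mono' (by fun_prop) (ae_of_all _ fun ν => ?_)
    simp only [Pi.add_apply, Real.norm_eq_abs, abs_mul, abs_two]
    have p1 := abs_nonneg (quot κ ν)
    have p2 := abs_nonneg (deriv (quot κ) ν)
    -- Near the origin both factors are bounded. Far away `|a'| ≤ L/|ν|`, and `2|a|/|ν| ≤ a² + ν⁻²`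
    -- is integrable there.
    rcases le_total (|ν|) 1 with h | h
    · have e1 : 2 * |quot κ ν| * |deriv (quot κ) ν| ≤ 2 * L * L := by
        gcongr
        exacts [hL ν, hL' ν]
      have e2 : 2 * L * L ≤ (4 * L ^ 2 + 2 * L) * (1 + ν ^ 2)⁻¹ := by
        rw [← div_eq_mul_inv, le_div_iff₀ (by positivity)]
        have : ν ^ 2 ≤ 1 := by rw [← sq_abs]; nlinarith [abs_nonneg ν]
        nlinarith [mul_nonneg hL0 hL0]
      nlinarith [mul_nonneg hL0 (sq_nonneg (quot κ ν))]
    · have h1 : 1 ≤ ν ^ 2 := by rw [← sq_abs]; nlinarith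
      have e1 : |deriv (quot κ) ν| ≤ L * |ν|⁻¹ := by
        rw [← div_eq_mul_inv, le_div_iff₀ (by positivity), mul_comm]
        exact hL'' ν h
      have e2 : 2 * |quot κ ν| * |deriv (quot κ) ν| ≤ 2 * |quot κ ν| * (L * |ν|⁻¹) := by gcongr
      have e3 : 2 * |quot κ ν| * |ν|⁻¹ ≤ quot κ ν ^ 2 + (ν ^ 2)⁻¹ := by
        rw [← sq_abs (quot κ ν), ← sq_abs ν, ← inv_pow]
        exact two_mul_le_add_sq _ _
      have e4 : (ν ^ 2)⁻¹ ≤ 2 * (1 + ν ^ 2)⁻¹ := by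
        rw [← div_eq_mul_inv, inv_eq_one_div, div_le_div_iff₀ (by positivity) (by positivity)]
        linarith
      have e5 : 0 ≤ 4 * L ^ 2 * (1 + ν ^ 2)⁻¹ := by positivity
      nlinarith [mul_le_mul_of_nonneg_left e3 hL0, mul_le_mul_of_nonneg_left e4 hL0]
  refine integrable_oscInt (fun ν => (hd ν).differentiableAt) hi
    (memLp_two_of_bounded hi (C := L ^ 2) fun ν => ?_) hi'
    (memLp_two_of_bounded hi' (C := 2 * L * L) fun ν => ?_)
  · rw [Complex.norm_real, Real.norm_of_nonneg (sq_nonneg _), ← sq_abs]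
    exact pow_le_pow_left₀ (abs_nonneg _) (hL ν) 2
  · rw [(hd ν).deriv, Complex.norm_real, Real.norm_eq_abs, abs_mul, abs_mul, abs_two]
    have := hL ν
    have := hL' ν
    gcongr

/-! ### Functions with bounded uniformly continuous derivatives -/

section Cb

variable {E : Type*} [NormedAddCommGroup E]

theorem Cb.add {f g : ℝ → E} (hf : f ∈ Cb E) (hg : g ∈ Cb E) : (fun t => f t + g t) ∈ Cb E := by
  obtain ⟨C, hC⟩ := hf.2
  obtain ⟨D, hD⟩ := hg.2
  exact ⟨hf.1.add hg.1, C + D, fun t => (norm_add_le _ _).trans (add_le_add (hC t) (hD t))⟩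

theorem Cb.const (c : E) : (fun _ => c) ∈ Cb E := ⟨uniformContinuous_const, ‖c‖, fun _ => le_rfl⟩

theorem Cb.clm [NormedSpace ℝ E] {F : Type*} [NormedAddCommGroup F] [NormedSpace ℝ F]
    (L : E →L[ℝ] F) {f : ℝ → E} (hf : f ∈ Cb E) : (fun t => L (f t)) ∈ Cb F := by
  obtain ⟨C, hC⟩ := hf.2
  exact ⟨L.uniformContinuous.comp hf.1, ‖L‖ * C, fun t =>
    (L.le_opNorm _).trans (mul_le_mul_of_nonneg_left (hC t) (norm_nonneg _))⟩

theorem Cb.mul {f g : ℝ → ℝ} (hf : f ∈ Cb ℝ) (hg : g ∈ Cb ℝ) : (fun t => f t * g t) ∈ Cb ℝ := by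
  obtain ⟨C, hC⟩ := hf.2
  obtain ⟨D, hD⟩ := hg.2
  have hC0 : 0 ≤ C := (norm_nonneg _).trans (hC 0)
  have hD0 : 0 ≤ D := (norm_nonneg _).trans (hD 0)
  refine ⟨Metric.uniformContinuous_iff.2 fun ε hε => ?_, C * D, fun t => ?_⟩
  · obtain ⟨δ₁, h₁, H₁⟩ := Metric.uniformContinuous_iff.1 hf.1 (ε / (C + D + 1)) (by positivity)
    obtain ⟨δ₂, h₂, H₂⟩ := Metric.uniformContinuous_iff.1 hg.1 (ε / (C + D + 1)) (by positivity)
    refine ⟨min δ₁ δ₂, lt_min h₁ h₂, fun a b hab => ?_⟩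
    have e₁ := (H₁ (hab.trans_le (min_le_left _ _))).le
    have e₂ := (H₂ (hab.trans_le (min_le_right _ _))).le
    rw [dist_eq_norm] at e₁ e₂ ⊢
    calc ‖f a * g a - f b * g b‖ = ‖(f a - f b) * g a + f b * (g a - g b)‖ := by ring_nf
      _ ≤ ‖f a - f b‖ * ‖g a‖ + ‖f b‖ * ‖g a - g b‖ := by
        rw [← norm_mul, ← norm_mul]; exact norm_add_le _ _
      _ ≤ ε / (C + D + 1) * D + C * (ε / (C + D + 1)) := by
        gcongr
        exacts [hD a, hC b]
      _ < ε / (C + D + 1) * (C + D + 1) := by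
        have : 0 < ε / (C + D + 1) := by positivity
        nlinarith
      _ = ε := by field_simp
  · rw [norm_mul]
    exact mul_le_mul (hC t) (hD t) (norm_nonneg _) hC0

theorem Cb.of_hasDerivAt [NormedSpace ℝ E] {f f' : ℝ → E} (h : ∀ t, HasDerivAt f (f' t) t)
    {C D : ℝ} (hC : ∀ t, ‖f t‖ ≤ C) (hD : ∀ t, ‖f' t‖ ≤ D) : f ∈ Cb E := by
  have hD0 : 0 ≤ D := (norm_nonneg _).trans (hD 0)
  refine ⟨(lipschitzWith_of_nnnorm_deriv_le (C := ⟨D, hD0⟩) (fun t => (h t).differentiableAt)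
    fun t => ?_).uniformContinuous, C, hC⟩
  rw [(h t).deriv]
  exact hD t

theorem Cb.comp_continuous {f : ℝ → ℝ} (hf : f ∈ Cb ℝ) {g : ℝ → ℝ} (hg : Continuous g) :
    (fun t => g (f t)) ∈ Cb ℝ := by
  obtain ⟨C, hC⟩ := hf.2
  have hmem : ∀ t, f t ∈ Metric.closedBall (0 : ℝ) C := fun t => by simpa using hC t
  have hcomp := isCompact_closedBall (0 : ℝ) C
  obtain ⟨D, hD⟩ := hcomp.exists_bound_of_continuousOn hg.continuousOn
  refine ⟨?_, D, fun t => hD _ (hmem t)⟩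
  have := hcomp.uniformContinuousOn_of_continuous hg.continuousOn
  rw [uniformContinuousOn_iff_restrict] at this
  exact this.comp (hf.1.subtype_mk hmem)

variable [NormedSpace ℝ E]

/-- `f` and its derivatives up to order `n` exist and belong to `C_b`. -/
def CbReg : ℕ → (ℝ → E) → Prop
  | 0, f => f ∈ Cb E
  | n + 1, f => f ∈ Cb E ∧ Differentiable ℝ f ∧ CbReg n (deriv f)

namespace CbReg

theorem mem_Cb {n : ℕ} {f : ℝ → E} (h : CbReg n f) : f ∈ Cb E := by
  cases n with
  | zero => exact h
  | succ n => exact h.1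

theorem of_hasDerivAt {n : ℕ} {f f' : ℝ → E} (hf : f ∈ Cb E) (h : ∀ t, HasDerivAt f (f' t) t)
    (h' : CbReg n f') : CbReg (n + 1) f :=
  ⟨hf, fun t => (h t).differentiableAt, by rwa [funext fun t => (h t).deriv]⟩

theorem pred {n : ℕ} {f : ℝ → E} (h : CbReg (n + 1) f) : CbReg n f := by
  induction n generalizing f with
  | zero => exact h.1
  | succ n ih => exact ⟨h.1, h.2.1, ih h.2.2⟩

theorem mono {m n : ℕ} (hmn : m ≤ n) {f : ℝ → E} (h : CbReg n f) : CbReg m f := by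
  induction n, hmn using Nat.le_induction with
  | base => exact h
  | succ n _ ih => exact ih h.pred

theorem add {n : ℕ} {f g : ℝ → E} (hf : CbReg n f) (hg : CbReg n g) :
    CbReg n (fun t => f t + g t) := by
  induction n generalizing f g with
  | zero => exact Cb.add hf hg
  | succ n ih =>
    exact of_hasDerivAt (Cb.add hf.1 hg.1)
      (fun t => (hf.2.1 t).hasDerivAt.add (hg.2.1 t).hasDerivAt) (ih hf.2.2 hg.2.2)

theorem clm {F : Type*} [NormedAddCommGroup F] [NormedSpace ℝ F]
    (L : E →L[ℝ] F) {n : ℕ} {f : ℝ → E} (hf : CbReg n f) : CbReg n (fun t => L (f t)) := by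
  induction n generalizing f with
  | zero => exact Cb.clm L hf
  | succ n ih =>
    exact of_hasDerivAt (Cb.clm L hf.1)
      (fun t => L.hasFDerivAt.comp_hasDerivAt t (hf.2.1 t).hasDerivAt) (ih hf.2.2)

theorem zero (n : ℕ) : CbReg n (fun _ : ℝ => (0 : E)) := by
  induction n with
  | zero => exact Cb.const 0
  | succ n ih => exact of_hasDerivAt (Cb.const 0) (fun t => hasDerivAt_const t 0) ih

theorem sum {ι : Type*} (s : Finset ι) {n : ℕ} {f : ι → ℝ → E} (hf : ∀ i ∈ s, CbReg n (f i)) :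
    CbReg n (fun t => ∑ i ∈ s, f i t) := by
  classical
  induction s using Finset.induction_on with
  | empty => simpa using zero n
  | insert i s hi ih =>
    simp only [Finset.sum_insert hi]
    exact (hf i (by simp)).add (ih fun j hj => hf j (by simp [hj]))

theorem mul {n : ℕ} {f g : ℝ → ℝ} (hf : CbReg n f) (hg : CbReg n g) :
    CbReg n (fun t => f t * g t) := by
  induction n generalizing f g with
  | zero => exact Cb.mul hf hg
  | succ n ih =>
    exact of_hasDerivAt (Cb.mul hf.1 hg.1)
      (fun t => (hf.2.1 t).hasDerivAt.mul (hg.2.1 t).hasDerivAt)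
      ((ih hf.2.2 hg.pred).add (ih hf.pred hg.2.2))

/-- The induction runs over all smooth `g` at once, since the chain rule replaces `g` by `g'`. -/
theorem comp_contDiff {n : ℕ} {f : ℝ → ℝ} (hf : CbReg n f) {g : ℝ → ℝ} (hg : ContDiff ℝ ∞ g) :
    CbReg n (fun t => g (f t)) := by
  induction n generalizing f g with
  | zero => exact Cb.comp_continuous hf hg.continuous
  | succ n ih =>
    have hg' : ContDiff ℝ ∞ (deriv g) := (contDiff_infty_iff_deriv.1 hg).2
    exact of_hasDerivAt (Cb.comp_continuous hf.1 hg.continuous)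
      (fun t => (hg.differentiable (by simp) (f t)).hasDerivAt.comp t (hf.2.1 t).hasDerivAt)
      ((ih hf.pred hg').mul hf.2.2)

theorem contDiff {n : ℕ} {f : ℝ → E} (hf : CbReg n f) : ContDiff ℝ (n : WithTop ℕ∞) f := by
  induction n generalizing f with
  | zero => exact contDiff_zero.2 hf.1.continuous
  | succ n ih =>
    push_cast
    exact contDiff_succ_iff_deriv.2 ⟨hf.2.1, by simp, ih hf.2.2⟩

theorem iteratedDeriv {n k : ℕ} (hk : k ≤ n) {f : ℝ → E} (hf : CbReg n f) :
    CbReg (n - k) (iteratedDeriv k f) := by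
  induction k generalizing n f with
  | zero => simpa using hf
  | succ k ih =>
    obtain ⟨n, rfl⟩ : ∃ m, n = m + 1 := ⟨n - 1, by omega⟩
    rw [iteratedDeriv_succ']
    simpa using ih (by omega : k ≤ n) hf.2.2

end CbReg

end Cb

/-- If `f → 0` along a translation invariant filter and `f'` is uniformly continuous then
`f' → 0`. -/
theorem tendsto_deriv_zero {l : Filter ℝ} (hl : ∀ c : ℝ, Tendsto (fun t => t + c) l l)
    {f f' : ℝ → ℝ} (h : ∀ t, HasDerivAt f (f' t) t) (hu : UniformContinuous f')
    (h0 : Tendsto f l (𝓝 0)) : Tendsto f' l (𝓝 0) := by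
  rw [Metric.tendsto_nhds]
  intro ε hε
  obtain ⟨δ, hδ, H⟩ := Metric.uniformContinuous_iff.1 hu (ε / 2) (by positivity)
  -- A difference quotient with a fixed step inherits the decay of `f`; by the mean value theorem it
  -- equals `f' c` with `c` within `δ` of `t`.
  have h1 : Tendsto (fun t => (f (t + δ / 2) - f t) / (δ / 2)) l (𝓝 0) := by
    simpa using ((h0.comp (hl (δ / 2))).sub h0).div_const (δ / 2)
  filter_upwards [Metric.tendsto_nhds.1 h1 (ε / 2) (by positivity)] with t ht
  obtain ⟨c, hc, hc'⟩ := exists_hasDerivAt_eq_slope f f' (show t < t + δ / 2 by linarith)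
    (fun x _ => (h x).continuousAt.continuousWithinAt) (fun x _ => h x)
  rw [add_sub_cancel_left] at hc'
  rw [← hc'] at ht
  have h2 : dist (f' t) (f' c) < ε / 2 := H (by
    rw [Real.dist_eq, abs_sub_comm, abs_of_pos (by linarith [hc.1])]
    linarith [hc.2])
  calc dist (f' t) 0 ≤ dist (f' t) (f' c) + dist (f' c) 0 := dist_triangle _ _ _
    _ < ε := by linarith

theorem CbReg.tendsto_iteratedDeriv {l : Filter ℝ} (hl : ∀ c : ℝ, Tendsto (fun t => t + c) l l)
    {n k : ℕ} (hk : k ≤ n) {f : ℝ → ℝ} (hf : CbReg n f) (h0 : Tendsto f l (𝓝 0)) :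
    Tendsto (_root_.iteratedDeriv k f) l (𝓝 0) := by
  induction k generalizing n f with
  | zero => simpa using h0
  | succ k ih =>
    obtain ⟨n, rfl⟩ : ∃ m, n = m + 1 := ⟨n - 1, by omega⟩
    rw [iteratedDeriv_succ']
    exact ih (by omega : k ≤ n) hf.2.2
      (tendsto_deriv_zero hl (fun t => (hf.2.1 t).hasDerivAt) hf.2.2.mem_Cb.1 h0)

theorem CbReg.iteratedDeriv_mem_C0 {n k : ℕ} (hk : k ≤ n) {f : ℝ → ℝ} (hf : CbReg n f)
    (h0 : Tendsto f atTop (𝓝 0)) (h0' : Tendsto f atBot (𝓝 0)) :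
    _root_.iteratedDeriv k f ∈ C0 ℝ :=
  ⟨⟨(hf.iteratedDeriv hk).mem_Cb, hf.tendsto_iteratedDeriv
      (fun c => tendsto_atTop_add_const_right _ c tendsto_id) hk h0⟩,
    ⟨(hf.iteratedDeriv hk).mem_Cb, hf.tendsto_iteratedDeriv
      (fun c => tendsto_atBot_add_const_right _ c tendsto_id) hk h0'⟩⟩

/-- A uniformly continuous square integrable function vanishes at infinity. -/
theorem tendsto_zero_of_lintegral_sq {E : Type*} [NormedAddCommGroup E] {f : ℝ → E}
    (hu : UniformContinuous f) (hf : ∫⁻ t, ‖f t‖ₑ ^ 2 ≠ ⊤) {l : Filter ℝ} [l.IsCountablyGenerated]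
    (hl : l ≤ cocompact ℝ) : Tendsto f l (𝓝 0) := by
  rw [Metric.tendsto_nhds]
  intro ε hε
  obtain ⟨δ, hδ, H⟩ := Metric.uniformContinuous_iff.1 hu (ε / 2) (by positivity)
  have hmeas : Measurable fun t => ‖f t‖ₑ ^ 2 :=
    (continuous_enorm.comp hu.continuous).measurable.pow_const 2
  -- The `L²` mass in a window of fixed width tends to `0` as the window escapes to infinity.
  have h1 : Tendsto (fun t => ∫⁻ s, (Set.Ioo (t - δ) (t + δ)).indicator (fun s => ‖f s‖ₑ ^ 2) s) l
      (𝓝 (∫⁻ _ : ℝ, 0)) := by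
    refine tendsto_lintegral_filter_of_dominated_convergence (fun s => ‖f s‖ₑ ^ 2)
      (Eventually.of_forall fun t => hmeas.indicator measurableSet_Ioo)
      (Eventually.of_forall fun t => ae_of_all _ fun s => Set.indicator_le_self _ _ _) hf
      (ae_of_all _ fun s => ?_)
    refine tendsto_const_nhds.congr' ?_
    have : ∀ᶠ t in l, t ∈ (Set.Icc (s - δ) (s + δ))ᶜ :=
      hl (isCompact_Icc.compl_mem_cocompact)
    filter_upwards [this] with t ht
    rw [Set.indicator_of_notMem]
    intro hs
    exact ht ⟨by linarith [hs.2], by linarith [hs.1]⟩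
  rw [lintegral_zero] at h1
  -- If `‖f t‖ ≥ ε`, then `‖f‖ ≥ ε/2` on the whole window, which therefore carries at least this
  -- mass.
  have hpos : (0 : ℝ≥0∞) < ENNReal.ofReal (ε / 2) ^ 2 * ENNReal.ofReal (2 * δ) :=
    ENNReal.mul_pos (by simp [hε]) (by simp [hδ])
  filter_upwards [h1.eventually (gt_mem_nhds hpos)] with t ht
  by_contra hcon
  refine absurd ht (not_lt.2 ?_)
  rw [lintegral_indicator measurableSet_Ioo]
  have hvol : (volume (Set.Ioo (t - δ) (t + δ))) = ENNReal.ofReal (2 * δ) := by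
    rw [Real.volume_Ioo]; congr 1; ring
  rw [← hvol, ← setLIntegral_const]
  refine setLIntegral_mono hmeas fun s hs => ?_
  gcongr
  rw [← ofReal_norm]
  refine ENNReal.ofReal_le_ofReal ?_
  have h2 : dist (f t) (f s) < ε / 2 := H (by
    rw [Real.dist_eq, abs_lt]; exact ⟨by linarith [hs.2], by linarith [hs.1]⟩)
  rw [dist_zero_right] at hcon
  rw [dist_eq_norm] at h2
  have := norm_le_norm_sub_add (f t) (f s)
  linarith

/-! ### Singular support of slowly varying functions -/

theorem Cb.integral_comp_sub {φ : ℝ → ℂ} (hφ : φ ∈ Cb ℂ) (ρ : Measure ℝ) [IsFiniteMeasure ρ] :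
    (fun t => ∫ s, φ (t - s) ∂ρ) ∈ Cb ℂ := by
  obtain ⟨C, hC⟩ := hφ.2
  have hint : ∀ t, Integrable (fun s => φ (t - s)) ρ := fun t =>
    Integrable.of_bound (hφ.1.continuous.comp (by fun_prop)).aestronglyMeasurable C
      (ae_of_all _ fun s => hC _)
  refine ⟨Metric.uniformContinuous_iff.2 fun ε hε => ?_, C * ρ.real Set.univ, fun t =>
    norm_integral_le_of_norm_le_const (ae_of_all _ fun s => hC _)⟩
  obtain ⟨δ, hδ, H⟩ := Metric.uniformContinuous_iff.1 hφ.1 (ε / (ρ.real Set.univ + 1))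
    (by positivity)
  refine ⟨δ, hδ, fun a b hab => ?_⟩
  rw [dist_eq_norm, ← integral_sub (hint a) (hint b)]
  have hle : ∀ s, ‖φ (a - s) - φ (b - s)‖ ≤ ε / (ρ.real Set.univ + 1) := fun s => by
    rw [← dist_eq_norm]
    exact (H (by rwa [dist_sub_right])).le
  refine (norm_integral_le_of_norm_le_const (ae_of_all _ hle)).trans_lt ?_
  rw [div_mul_eq_mul_div, div_lt_iff₀ (by positivity)]
  nlinarith

theorem tendsto_integral_comp_sub {φ : ℝ → ℂ} (hφ : φ ∈ Cb ℂ) (ρ : Measure ℝ) [IsFiniteMeasure ρ]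
    {l : Filter ℝ} [l.IsCountablyGenerated]
    (hl : ∀ s, Tendsto (fun t => φ (t - s) - φ t) l (𝓝 0)) :
    Tendsto (fun t => ∫ s, φ (t - s) ∂ρ - φ t * ∫ _, (1 : ℂ) ∂ρ) l (𝓝 0) := by
  obtain ⟨C, hC⟩ := hφ.2
  have hint : ∀ t, Integrable (fun s => φ (t - s)) ρ := fun t =>
    Integrable.of_bound (hφ.1.continuous.comp (by fun_prop)).aestronglyMeasurable C
      (ae_of_all _ fun s => hC _)
  have e : ∀ t, ∫ s, φ (t - s) ∂ρ - φ t * ∫ _, (1 : ℂ) ∂ρ = ∫ s, (φ (t - s) - φ t) ∂ρ := fun t => by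
    rw [integral_sub (hint t) (integrable_const _), ← integral_const_mul]
    simp
  rw [funext e, ← integral_zero ℝ ℂ (μ := ρ)]
  refine tendsto_integral_filter_of_dominated_convergence (fun _ => 2 * C)
    (Eventually.of_forall fun t => ((hint t).sub (integrable_const _)).1)
    (Eventually.of_forall fun t => ae_of_all _ fun s => ?_) (integrable_const _)
    (ae_of_all _ hl)
  rw [two_mul]
  exact (norm_sub_le _ _).trans (add_le_add (hC _) (hC _))

theorem Cb.convMeasure {φ : ℝ → ℂ} (hφ : φ ∈ Cb ℂ) (μ : ComplexMeasure ℝ) : cmConv φ μ ∈ Cb ℂ := by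
  have hneg : ∀ {f : ℝ → ℂ}, f ∈ Cb ℂ → (fun t => -f t) ∈ Cb ℂ := fun hf => by
    simpa using Cb.clm (-ContinuousLinearMap.id ℝ ℂ) hf
  have hI : ∀ {f : ℝ → ℂ}, f ∈ Cb ℂ → (fun t => Complex.I * f t) ∈ Cb ℂ := fun hf =>
    Cb.clm (ContinuousLinearMap.mul ℝ ℂ Complex.I) hf
  have h1 := Cb.integral_comp_sub hφ (ComplexMeasure.re μ).toJordanDecomposition.posPart
  have h2 := Cb.integral_comp_sub hφ (ComplexMeasure.re μ).toJordanDecomposition.negPart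
  have h3 := Cb.integral_comp_sub hφ (ComplexMeasure.im μ).toJordanDecomposition.posPart
  have h4 := Cb.integral_comp_sub hφ (ComplexMeasure.im μ).toJordanDecomposition.negPart
  have := Cb.add (Cb.add h1 (hneg h2)) (hI (Cb.add h3 (hneg h4)))
  simp only [← sub_eq_add_neg] at this
  exact this

/-- By dominated convergence `φ * μ` differs from `φ · μ(ℝ)` by a term tending to `0`, and `μ(ℝ) =
μ̂(0)`. -/
theorem tendsto_cmConv {φ : ℝ → ℂ} (hφ : φ ∈ Cb ℂ) (μ : ComplexMeasure ℝ)
    (hμ : cmFourier μ 0 = 0) {l : Filter ℝ} [l.IsCountablyGenerated]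
    (hl : ∀ s, Tendsto (fun t => φ (t - s) - φ t) l (𝓝 0)) :
    Tendsto (cmConv φ μ) l (𝓝 0) := by
  have h1 := tendsto_integral_comp_sub hφ (ComplexMeasure.re μ).toJordanDecomposition.posPart hl
  have h2 := tendsto_integral_comp_sub hφ (ComplexMeasure.re μ).toJordanDecomposition.negPart hl
  have h3 := tendsto_integral_comp_sub hφ (ComplexMeasure.im μ).toJordanDecomposition.posPart hl
  have h4 := tendsto_integral_comp_sub hφ (ComplexMeasure.im μ).toJordanDecomposition.negPart hl
  have h := (h1.sub h2).add ((h3.sub h4).const_mul Complex.I)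
  simp only [sub_zero, mul_zero, add_zero] at h
  refine h.congr fun t => ?_
  have hμ' : cmIntegral μ (fun _ => 1) = 0 := by simpa [cmFourier] using hμ
  rw [cmIntegral] at hμ'
  rw [cmConv, cmIntegral]
  linear_combination (-φ t) * hμ'

/-- A nonzero frequency has an open interval around it that omits `0`. Every `μ` with spectrum in
that interval has `μ̂(0) = 0`, so `φ * μ` decays. -/
theorem ssuppHat_subset_zero {φ : ℝ → ℂ} (hφ : φ ∈ Cb ℂ)
    (hT : ∀ s, Tendsto (fun t => φ (t - s) - φ t) atTop (𝓝 0))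
    (hB : ∀ s, Tendsto (fun t => φ (t - s) - φ t) atBot (𝓝 0)) : ssuppHat φ ⊆ {0} := by
  intro x hx
  by_contra hx0
  rw [Set.mem_singleton_iff] at hx0
  obtain ⟨a, b, hxab, h0⟩ : ∃ a b : ℝ, x ∈ Set.Ioo a b ∧ (0 : ℝ) ∉ Set.Ioo a b := by
    rcases lt_or_gt_of_ne hx0 with h | h
    · exact ⟨x - 1, 0, ⟨by linarith, h⟩, fun h' => lt_irrefl _ h'.2⟩
    · exact ⟨0, x + 1, ⟨h, by linarith⟩, fun h' => lt_irrefl _ h'.1⟩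
  have hz : ∀ μ : ComplexMeasure ℝ, tsupport (cmFourier μ) ⊆ Set.Ioo a b → cmFourier μ 0 = 0 :=
    fun μ hμ => image_eq_zero_of_notMem_tsupport fun h => h0 (hμ h)
  rcases hx with hx | hx
  · obtain ⟨μ, hμ, hn⟩ := hx a b hxab
    exact hn ⟨Cb.convMeasure hφ μ, tendsto_cmConv hφ μ (hz μ hμ) hT⟩
  · obtain ⟨μ, hμ, hn⟩ := hx a b hxab
    exact hn ⟨Cb.convMeasure hφ μ, tendsto_cmConv hφ μ (hz μ hμ) hB⟩

/-! ### The complex amplitude of a driven continuum of oscillators -/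

theorem integrable_norm_sq_of_memLp {f : ℝ → ℂ} (hf : MemLp f 2 volume) :
    Integrable fun x => ‖f x‖ ^ 2 :=
  (memLp_two_iff_integrable_sq_norm hf.1).1 hf

theorem norm_integral_mul_le_sqrt {f g : ℝ → ℂ} (hf : MemLp f 2 volume) (hg : MemLp g 2 volume) :
    ‖∫ x, f x * g x‖ ≤ √(∫ x, ‖f x‖ ^ 2) * √(∫ x, ‖g x‖ ^ 2) := by
  refine (norm_integral_le_integral_norm _).trans ?_
  have h := integral_mul_norm_le_Lp_mul_Lq (μ := volume) (f := f) (g := g)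
    Real.HolderConjugate.two_two (by simpa using hf) (by simpa using hg)
  simpa [Real.sqrt_eq_rpow] using h

/-- `∫₀ᵗ exp(-i ν s) v(s) ds`. -/
def phaseInt (v : ℝ → ℝ) (t ν : ℝ) : ℂ :=
  ∫ s in (0 : ℝ)..t, Complex.exp (-(Complex.I * ν * s)) * v s

/-- The amplitude in the rotating frame. -/
def profile (a : ℝ → ℝ) (w₀ : ℝ → ℂ) (v : ℝ → ℝ) (t ν : ℝ) : ℂ :=
  w₀ ν - Complex.I * a ν * phaseInt v t ν

/-- The solution of `∂ₜ w = i ν w - i a(ν) v(t)` with `w(0) = w₀`. -/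
def amp (a : ℝ → ℝ) (w₀ : ℝ → ℂ) (v : ℝ → ℝ) (t ν : ℝ) : ℂ :=
  Complex.exp (Complex.I * ν * t) * profile a w₀ v t ν

theorem norm_exp_I_mul_mul (x y : ℝ) : ‖Complex.exp (Complex.I * x * y)‖ = 1 := by
  rw [mul_assoc, ← Complex.ofReal_mul, mul_comm, Complex.norm_exp_ofReal_mul_I]

theorem norm_exp_neg_I_mul_mul (x y : ℝ) : ‖Complex.exp (-(Complex.I * x * y))‖ = 1 := by
  simpa using norm_exp_I_mul_mul x (-y)

theorem norm_amp (a : ℝ → ℝ) (w₀ : ℝ → ℂ) (v : ℝ → ℝ) (t ν : ℝ) :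
    ‖amp a w₀ v t ν‖ = ‖profile a w₀ v t ν‖ := by
  rw [amp, norm_mul, norm_exp_I_mul_mul, one_mul]

theorem continuous_phase_mul {v : ℝ → ℝ} (hv : Continuous v) (ν : ℝ) :
    Continuous fun s : ℝ => Complex.exp (-(Complex.I * ν * s)) * v s := by fun_prop

theorem hasDerivAt_phaseInt {v : ℝ → ℝ} (hv : Continuous v) (ν t : ℝ) :
    HasDerivAt (fun t => phaseInt v t ν) (Complex.exp (-(Complex.I * ν * t)) * v t) t :=
  (continuous_phase_mul hv ν).integral_hasStrictDerivAt 0 t |>.hasDerivAt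

theorem continuous_phaseInt {v : ℝ → ℝ} (hv : Continuous v) (t : ℝ) :
    Continuous (phaseInt v t) :=
  intervalIntegral.continuous_parametric_intervalIntegral_of_continuous' (by fun_prop) 0 t

theorem norm_phaseInt_sub_le {v : ℝ → ℝ} (hv : Continuous v) {D : ℝ} (s t ν : ℝ)
    (hD : ∀ x ∈ Set.uIoc s t, |v x| ≤ D) : ‖phaseInt v t ν - phaseInt v s ν‖ ≤ D * |t - s| := by
  rw [phaseInt, phaseInt, intervalIntegral.integral_interval_sub_left
    ((continuous_phase_mul hv ν).intervalIntegrable _ _)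
    ((continuous_phase_mul hv ν).intervalIntegrable _ _)]
  refine intervalIntegral.norm_integral_le_of_norm_le_const fun x hx => ?_
  rw [norm_mul, norm_exp_neg_I_mul_mul, one_mul, Complex.norm_real]
  exact hD x hx

theorem exists_bound_phaseInt {v : ℝ → ℝ} (hv : Continuous v) (T : ℝ) :
    ∃ D, 0 ≤ D ∧ ∀ t, |t| ≤ T → |v t| ≤ D ∧ ∀ ν, ‖phaseInt v t ν‖ ≤ D := by
  obtain ⟨C, hC⟩ := (isCompact_closedBall (0 : ℝ) T).exists_bound_of_continuousOn hv.continuousOn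
  have hb : ∀ x, |x| ≤ T → |v x| ≤ |C| := fun x hx =>
    (hC x (by simpa using hx)).trans (le_abs_self C)
  refine ⟨|C| * (1 + |T|), by positivity, fun t ht => ⟨?_, fun ν => ?_⟩⟩
  · nlinarith [hb t ht, mul_nonneg (abs_nonneg C) (abs_nonneg T)]
  · have := norm_phaseInt_sub_le hv 0 t ν (D := |C|) fun x hx => hb x (by
      have h := Set.uIoc_subset_uIcc hx
      rw [Set.mem_uIcc] at h
      rw [abs_le] at ht ⊢
      rcases h with h | h <;> constructor <;> linarith [h.1, h.2])
    have h0 : phaseInt v 0 ν = 0 := by simp [phaseInt]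
    rw [h0, sub_zero, sub_zero] at this
    refine this.trans (mul_le_mul_of_nonneg_left ?_ (abs_nonneg C))
    linarith [le_abs_self T]

/-- Standing assumptions on the coupling `a`, the initial amplitude and the velocity. -/
structure AmpData (a : ℝ → ℝ) (w₀ : ℝ → ℂ) (v : ℝ → ℝ) : Prop where
  cont_a : Continuous a
  memLp_a : MemLp a 2 volume
  memLp_w₀ : MemLp w₀ 2 volume
  cont_v : Continuous v

namespace AmpData

variable {a : ℝ → ℝ} {w₀ : ℝ → ℂ} {v : ℝ → ℝ} (h : AmpData a w₀ v)
include h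

theorem aestronglyMeasurable_profile (t : ℝ) :
    AEStronglyMeasurable (profile a w₀ v t) volume := by
  have := h.cont_a
  have := continuous_phaseInt h.cont_v t
  exact h.memLp_w₀.1.sub (Continuous.aestronglyMeasurable (by fun_prop))

theorem aestronglyMeasurable_amp (t : ℝ) : AEStronglyMeasurable (amp a w₀ v t) volume :=
  (Continuous.aestronglyMeasurable (by fun_prop)).mul (h.aestronglyMeasurable_profile t)

/-- A square integrable function dominates the amplitudes on bounded time intervals. -/
theorem exists_dominating (T : ℝ) : ∃ (D : ℝ) (g : ℝ → ℝ), 0 ≤ D ∧ MemLp g 2 volume ∧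
    (∀ ν, 0 ≤ g ν) ∧ ∀ t, |t| ≤ T → |v t| ≤ D ∧ ∀ ν, ‖profile a w₀ v t ν‖ ≤ g ν := by
  obtain ⟨D, hD0, hD⟩ := exists_bound_phaseInt h.cont_v T
  refine ⟨D, fun ν => ‖w₀ ν‖ + D * ‖a ν‖, hD0, h.memLp_w₀.norm.add (h.memLp_a.norm.const_mul D),
    fun ν => by positivity, fun t ht => ⟨(hD t ht).1, fun ν => ?_⟩⟩
  refine (norm_sub_le _ _).trans (add_le_add le_rfl ?_)
  rw [norm_mul, norm_mul, Complex.norm_I, one_mul, Complex.norm_real, mul_comm]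
  exact mul_le_mul_of_nonneg_right ((hD t ht).2 ν) (norm_nonneg _)

theorem memLp_profile (t : ℝ) : MemLp (profile a w₀ v t) 2 volume := by
  obtain ⟨D, g, -, hg, -, H⟩ := h.exists_dominating |t|
  exact hg.mono' (h.aestronglyMeasurable_profile t) (ae_of_all _ (H t le_rfl).2)

theorem memLp_amp (t : ℝ) : MemLp (amp a w₀ v t) 2 volume :=
  (h.memLp_profile t).of_le (h.aestronglyMeasurable_amp t)
    (ae_of_all _ fun ν => (norm_amp a w₀ v t ν).le)

omit h in
theorem hasDerivAt_profile (hv : Continuous v) (t ν : ℝ) :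
    HasDerivAt (fun t => profile a w₀ v t ν)
      (-(Complex.I * a ν * (Complex.exp (-(Complex.I * ν * t)) * v t))) t := by
  simpa [profile] using!
    ((hasDerivAt_phaseInt hv ν t).const_mul (Complex.I * a ν)).const_sub (w₀ ν)

omit h in
theorem hasDerivAt_amp (hv : Continuous v) (t ν : ℝ) :
    HasDerivAt (fun t => amp a w₀ v t ν)
      (Complex.I * ν * amp a w₀ v t ν - Complex.I * a ν * v t) t := by
  have h1 : HasDerivAt (fun t : ℝ => Complex.exp (Complex.I * ν * t))
      (Complex.exp (Complex.I * ν * t) * (Complex.I * ν)) t := by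
    have := (((hasDerivAt_id t).ofReal_comp).const_mul (Complex.I * ν)).cexp
    simpa using this
  refine (h1.mul (hasDerivAt_profile hv t ν)).congr_deriv ?_
  rw [amp, Complex.exp_neg]
  field_simp [Complex.exp_ne_zero]
  ring

/-- Balance of energy. -/
theorem hasDerivAt_energy (t : ℝ) :
    HasDerivAt (fun t => ∫ ν, ‖amp a w₀ v t ν‖ ^ 2)
      (-(2 * v t * (∫ ν, (a ν : ℂ) * amp a w₀ v t ν).im)) t := by
  obtain ⟨D, g, hD, hg, hg0, H⟩ := h.exists_dominating (|t| + 1)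
  have hball : ∀ x ∈ Metric.ball t 1, |x| ≤ |t| + 1 := fun x hx => by
    have := mem_ball_iff_norm.1 hx
    rw [Real.norm_eq_abs] at this
    have := abs_sub_abs_le_abs_sub x t
    linarith
  -- In the rotating frame the rotation drops out of the modulus, so the time derivative contains no
  -- unbounded factor `ν` and can be dominated without further moments.
  simp only [norm_amp]
  have hd : ∀ x ν, HasDerivAt (fun t => ‖profile a w₀ v t ν‖ ^ 2)
      (-(2 * v x * ((a ν : ℂ) * amp a w₀ v x ν).im)) x := fun x ν => by
    refine (hasDerivAt_profile h.cont_v x ν).norm_sq.congr_deriv ?_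
    rw [real_inner_eq_re_inner ℂ, RCLike.inner_apply]
    rw [amp]
    have e : Complex.exp (-(Complex.I * ν * x)) =
        (starRingEnd ℂ) (Complex.exp (Complex.I * ν * x)) := by
      rw [← Complex.exp_conj]; simp
    rw [e]
    generalize Complex.exp (Complex.I * ν * x) = z
    generalize profile a w₀ v x ν = p
    simp
    ring
  have hm : ∀ x, AEStronglyMeasurable (fun ν => -(2 * v x * ((a ν : ℂ) * amp a w₀ v x ν).im))
      volume := fun x => by
    have h1 : AEStronglyMeasurable (fun ν => (a ν : ℂ) * amp a w₀ v x ν) volume :=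
      (Complex.continuous_ofReal.comp h.cont_a).aestronglyMeasurable.mul
        (h.aestronglyMeasurable_amp x)
    exact ((Complex.continuous_im.comp_aestronglyMeasurable h1).const_mul _).neg
  have key := (hasDerivAt_integral_of_dominated_loc_of_deriv_le (μ := volume)
    (bound := fun ν => 2 * D * (‖a ν‖ * g ν))
    (F := fun t ν => ‖profile a w₀ v t ν‖ ^ 2)
    (F' := fun x ν => -(2 * v x * ((a ν : ℂ) * amp a w₀ v x ν).im))
    (Metric.ball_mem_nhds t one_pos)
    (Eventually.of_forall fun x => (h.aestronglyMeasurable_profile x).norm.pow 2)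
    (integrable_norm_sq_of_memLp (h.memLp_profile t)) (hm t)
    (ae_of_all _ fun ν x hx => ?_)
    ((h.memLp_a.norm.integrable_mul hg).const_mul _)
    (ae_of_all _ fun ν x _ => hd x ν)).2
  · refine key.congr_deriv ?_
    rw [integral_neg, integral_const_mul]
    congr 2
    exact integral_im (h.memLp_a.ofReal.integrable_mul (h.memLp_amp t))
  · obtain ⟨h1, h2⟩ := H x (hball x hx)
    rw [norm_neg, norm_mul, norm_mul, Real.norm_two, Real.norm_eq_abs]
    have h3 : ‖((a ν : ℂ) * amp a w₀ v x ν).im‖ ≤ ‖a ν‖ * g ν := by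
      refine (Complex.abs_im_le_norm _).trans ?_
      rw [norm_mul, norm_amp, Complex.norm_real]
      exact mul_le_mul_of_nonneg_left (h2 ν) (norm_nonneg _)
    gcongr

/-- The equation of motion of a linear functional of the amplitude. -/
theorem hasDerivAt_functional {c : ℝ → ℂ} (hc : MemLp c 2 volume)
    (hc' : MemLp (fun ν => ν * c ν) 2 volume) (t : ℝ) :
    HasDerivAt (fun t => ∫ ν, c ν * amp a w₀ v t ν)
      (Complex.I * (∫ ν, (ν * c ν) * amp a w₀ v t ν) - Complex.I * (∫ ν, c ν * a ν) * v t) t := by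
  obtain ⟨D, g, hD, hg, hg0, H⟩ := h.exists_dominating (|t| + 1)
  have hball : ∀ x ∈ Metric.ball t 1, |x| ≤ |t| + 1 := fun x hx => by
    have := mem_ball_iff_norm.1 hx
    rw [Real.norm_eq_abs] at this
    have := abs_sub_abs_le_abs_sub x t
    linarith
  have hca : Integrable (fun ν => c ν * (a ν : ℂ)) := hc.integrable_mul h.memLp_a.ofReal
  have hcn : ∀ x, Integrable (fun ν => (ν * c ν) * amp a w₀ v x ν) := fun x =>
    hc'.integrable_mul (h.memLp_amp x)
  have hF' : ∀ x, Integrable (fun ν => Complex.I * ((ν * c ν) * amp a w₀ v x ν)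
      - Complex.I * v x * (c ν * a ν)) := fun x =>
    ((hcn x).const_mul _).sub (hca.const_mul _)
  have key := (hasDerivAt_integral_of_dominated_loc_of_deriv_le (μ := volume)
    (bound := fun ν => ‖ν * c ν‖ * g ν + D * ‖c ν * a ν‖)
    (F := fun t ν => c ν * amp a w₀ v t ν)
    (F' := fun x ν => Complex.I * ((ν * c ν) * amp a w₀ v x ν)
      - Complex.I * v x * (c ν * a ν))
    (Metric.ball_mem_nhds t one_pos)
    (Eventually.of_forall fun x => hc.1.mul (h.aestronglyMeasurable_amp x))
    (hc.integrable_mul (h.memLp_amp t)) (hF' t).1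
    (ae_of_all _ fun ν x hx => ?_)
    ((hc'.norm.integrable_mul hg).add (hca.norm.const_mul _))
    (ae_of_all _ fun ν x _ => ?_)).2
  · refine key.congr_deriv ?_
    rw [integral_sub ((hcn t).const_mul _) (hca.const_mul _), integral_const_mul,
      integral_const_mul]
    ring
  · obtain ⟨h1, h2⟩ := H x (hball x hx)
    refine (norm_sub_le _ _).trans (add_le_add ?_ ?_)
    · rw [norm_mul, Complex.norm_I, one_mul, norm_mul, norm_amp]
      exact mul_le_mul_of_nonneg_left (h2 ν) (norm_nonneg _)
    · rw [norm_mul, norm_mul, Complex.norm_I, one_mul, Complex.norm_real]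
      exact mul_le_mul_of_nonneg_right h1 (norm_nonneg _)
  · refine ((hasDerivAt_amp h.cont_v x ν).const_mul (c ν)).congr_deriv ?_
    ring

theorem norm_functional_le {c : ℝ → ℂ} (hc : MemLp c 2 volume) (t : ℝ) {M : ℝ}
    (hM : ∫ ν, ‖amp a w₀ v t ν‖ ^ 2 ≤ M) :
    ‖∫ ν, c ν * amp a w₀ v t ν‖ ≤ √(∫ ν, ‖c ν‖ ^ 2) * √M :=
  (norm_integral_mul_le_sqrt hc (h.memLp_amp t)).trans
    (mul_le_mul_of_nonneg_left (Real.sqrt_le_sqrt hM) (Real.sqrt_nonneg _))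

omit h in
-- The increment splits into a free rotation and the effect of the drive during the time `d`.
theorem amp_add (a : ℝ → ℝ) (w₀ : ℝ → ℂ) (v : ℝ → ℝ) (t d ν : ℝ) :
    amp a w₀ v (t + d) ν - amp a w₀ v t ν = (Complex.exp (Complex.I * ν * d) - 1) * amp a w₀ v t ν
      - Complex.I * a ν * (Complex.exp (Complex.I * ν * (t + d : ℝ)) *
        (phaseInt v (t + d) ν - phaseInt v t ν)) := by
  have : Complex.exp (Complex.I * ν * (t + d : ℝ)) =
      Complex.exp (Complex.I * ν * t) * Complex.exp (Complex.I * ν * d) := by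
    rw [← Complex.exp_add]; push_cast; ring_nf
  simp only [amp, profile]
  rw [this]
  ring

omit h in
theorem tendsto_integral_phase_sub_one {c : ℝ → ℂ} (hc : MemLp c 2 volume) :
    Tendsto (fun d : ℝ => ∫ ν, ‖c ν * (Complex.exp (Complex.I * ν * d) - 1)‖ ^ 2) (𝓝 0) (𝓝 0) := by
  have hb : ∀ d ν : ℝ, ‖c ν * (Complex.exp (Complex.I * ν * d) - 1)‖ ^ 2 ≤ 4 * ‖c ν‖ ^ 2 :=
    fun d ν => by
      have : ‖Complex.exp (Complex.I * ν * d) - 1‖ ≤ 2 := by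
        refine (norm_sub_le _ _).trans ?_
        rw [norm_exp_I_mul_mul, norm_one]; norm_num
      rw [norm_mul, mul_pow]
      nlinarith [pow_le_pow_left₀ (norm_nonneg _) this 2, sq_nonneg ‖c ν‖]
  have : ContinuousAt
      (fun d : ℝ => ∫ ν, ‖c ν * (Complex.exp (Complex.I * ν * d) - 1)‖ ^ 2) 0 := by
    refine continuousAt_of_dominated (bound := fun ν => 4 * ‖c ν‖ ^ 2)
      (Eventually.of_forall fun d => ?_) (Eventually.of_forall fun d => ae_of_all _ fun ν => ?_)
      ((integrable_norm_sq_of_memLp hc).const_mul 4) (ae_of_all _ fun ν => ?_)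
    · exact (hc.1.mul (Continuous.aestronglyMeasurable (by fun_prop))).norm.pow 2
    · rw [Real.norm_of_nonneg (by positivity)]
      exact hb d ν
    · fun_prop
  simpa [ContinuousAt] using this

/-- No moment `ν c` is needed. The rotation over a time `d` is transferred to the weight `c`, where
it is small in `L²` uniformly in `t`; the drive contributes at most `D |d|` times the `L¹` norm of
`c a`. -/
theorem functional_mem_Cb {c : ℝ → ℂ} (hc : MemLp c 2 volume) {M D : ℝ}
    (hM : ∀ t, ∫ ν, ‖amp a w₀ v t ν‖ ^ 2 ≤ M) (hD : ∀ t, |v t| ≤ D) :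
    (fun t => ∫ ν, c ν * amp a w₀ v t ν) ∈ Cb ℂ := by
  refine ⟨Metric.uniformContinuous_iff.2 fun ε hε => ?_, _, fun t => h.norm_functional_le hc t (hM t)⟩
  have hca : Integrable (fun ν => c ν * (a ν : ℂ)) := hc.integrable_mul h.memLp_a.ofReal
  set A := ∫ ν, ‖c ν * a ν‖
  have hlim : Tendsto (fun d : ℝ => √(∫ ν, ‖c ν * (Complex.exp (Complex.I * ν * d) - 1)‖ ^ 2) * √M
      + A * (D * |d|)) (𝓝 0) (𝓝 0) := by
    have h1 := ((tendsto_integral_phase_sub_one hc).sqrt).mul_const √M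
    have h2 : Tendsto (fun d : ℝ => A * (D * |d|)) (𝓝 0) (𝓝 (A * (D * |0|))) :=
      (Continuous.tendsto (by fun_prop) 0)
    simpa using h1.add h2
  obtain ⟨δ, hδ, H⟩ := Metric.eventually_nhds_iff.1 (hlim.eventually (gt_mem_nhds hε))
  refine ⟨δ, hδ, fun x t hxt => ?_⟩
  obtain ⟨d, rfl⟩ : ∃ d, x = t + d := ⟨x - t, by ring⟩
  have hd : dist d 0 < δ := by simpa [dist_eq_norm] using hxt
  refine lt_of_le_of_lt ?_ (H hd)
  have hc1 : MemLp (fun ν : ℝ => c ν * (Complex.exp (Complex.I * ν * d) - 1)) 2 volume := by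
    refine (hc.norm.const_mul 2).mono'
      (hc.1.mul (Continuous.aestronglyMeasurable (by fun_prop))) (ae_of_all _ fun ν => ?_)
    have : ‖Complex.exp (Complex.I * ν * d) - 1‖ ≤ 2 := by
      refine (norm_sub_le _ _).trans ?_
      rw [norm_exp_I_mul_mul, norm_one]; norm_num
    rw [norm_mul, mul_comm]
    exact mul_le_mul_of_nonneg_right this (norm_nonneg _)
  have hbd : ∀ ν, ‖Complex.I * (c ν * a ν) * (Complex.exp (Complex.I * ν * (t + d : ℝ)) *
        (phaseInt v (t + d) ν - phaseInt v t ν))‖ ≤ ‖c ν * a ν‖ * (D * |d|) := fun ν => by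
    rw [norm_mul, norm_mul, norm_mul (Complex.exp _), norm_exp_I_mul_mul, Complex.norm_I, one_mul,
      one_mul]
    refine mul_le_mul_of_nonneg_left ?_ (norm_nonneg _)
    have := norm_phaseInt_sub_le h.cont_v t (t + d) ν (D := D) fun x _ => hD x
    rwa [add_sub_cancel_left] at this
  have hi1 : Integrable fun ν => (c ν * (Complex.exp (Complex.I * ν * d) - 1)) * amp a w₀ v t ν :=
    hc1.integrable_mul (h.memLp_amp t)
  have hi0 : ∀ x, Integrable fun ν => c ν * amp a w₀ v x ν := fun x =>
    hc.integrable_mul (h.memLp_amp x)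
  have hi2 : Integrable (fun ν => Complex.I * (c ν * a ν) *
      (Complex.exp (Complex.I * ν * (t + d : ℝ)) *
        (phaseInt v (t + d) ν - phaseInt v t ν))) := by
    refine (hca.norm.mul_const (D * |d|)).mono' ?_ (ae_of_all _ hbd)
    have c1 := continuous_phaseInt h.cont_v t
    have c2 := continuous_phaseInt h.cont_v (t + d)
    exact (hca.1.const_mul _).mul (Continuous.aestronglyMeasurable (by fun_prop))
  rw [dist_eq_norm, ← integral_sub (hi0 _) (hi0 _)]
  have e : ∀ ν, c ν * amp a w₀ v (t + d) ν - c ν * amp a w₀ v t ν =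
      (c ν * (Complex.exp (Complex.I * ν * d) - 1)) * amp a w₀ v t ν -
      Complex.I * (c ν * a ν) * (Complex.exp (Complex.I * ν * (t + d : ℝ)) *
        (phaseInt v (t + d) ν - phaseInt v t ν)) := fun ν => by
    rw [← mul_sub, amp_add]; ring
  simp_rw [e]
  rw [integral_sub hi1 hi2]
  refine (norm_sub_le _ _).trans (add_le_add (h.norm_functional_le hc1 t (hM t)) ?_)
  rw [← integral_mul_const]
  exact norm_integral_le_of_norm_le (hca.norm.mul_const _) (ae_of_all _ hbd)

end AmpData

/-- Fubini: a product in frequency is a convolution in time, here with the drive cut off to `[α,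
β]`. -/
theorem oscInt_mul_intervalIntegral {f : ℝ → ℂ} (hf : Integrable f) {v : ℝ → ℝ}
    (hv : Continuous v) (α β t : ℝ) :
    oscInt (fun ν => f ν * ∫ s in α..β, Complex.exp (-(Complex.I * ν * s)) * v s) t =
      ∫ s in α..β, oscInt f (t - s) * v s := by
  have hswap := intervalIntegral_integral_swap (μ := volume) (a := α) (b := β)
    (f := fun s (ν : ℝ) => (Complex.exp (Complex.I * ν * (t - s : ℝ)) * f ν) * v s) ?_
  · rw [oscInt]
    simp only [oscInt, ← integral_mul_const]
    rw [hswap]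
    refine integral_congr_ae (ae_of_all _ fun ν => ?_)
    simp only
    rw [← mul_assoc, ← intervalIntegral.integral_const_mul]
    refine intervalIntegral.integral_congr fun s _ => ?_
    have : Complex.exp (Complex.I * ν * (t - s : ℝ)) =
        Complex.exp (Complex.I * ν * t) * Complex.exp (-(Complex.I * ν * s)) := by
      rw [← Complex.exp_add]; push_cast; ring_nf
    simp only [this]
    ring
  · have hvi : Integrable v (volume.restrict (Set.uIoc α β)) := by
      rw [← IntegrableOn, ← intervalIntegrable_iff]
      exact hv.intervalIntegrable _ _
    refine (hvi.ofReal (𝕜 := ℂ)).mul_prod hf |>.norm.mono' ?_ (ae_of_all _ fun p => ?_)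
    · refine AEStronglyMeasurable.mul (AEStronglyMeasurable.mul ?_ ?_) ?_
      · exact Continuous.aestronglyMeasurable (by fun_prop)
      · exact hf.1.comp_snd
      · exact Continuous.aestronglyMeasurable (by fun_prop)
    · simp only [Function.uncurry, norm_mul, norm_exp_I_mul_mul, one_mul]
      rw [mul_comm]
      rfl

namespace AmpData

variable {a : ℝ → ℝ} {w₀ : ℝ → ℂ} {v : ℝ → ℝ} (h : AmpData a w₀ v)
include h

/-- Duhamel's formula: the free evolution plus a memory term whose kernel is the transform of `a²`.
-/
theorem functional_eq (t : ℝ) : ∫ ν, (a ν : ℂ) * amp a w₀ v t ν =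
    oscInt (fun ν => a ν * w₀ ν) t -
      Complex.I * ∫ s in (0 : ℝ)..t, oscInt (fun ν => ((a ν ^ 2 : ℝ) : ℂ)) (t - s) * v s := by
  have h1 : Integrable (fun ν => (a ν : ℂ) * w₀ ν) := h.memLp_a.ofReal.integrable_mul h.memLp_w₀
  have h2 : Integrable (fun ν => ((a ν ^ 2 : ℝ) : ℂ)) := h.memLp_a.integrable_sq.ofReal
  obtain ⟨D, hD0, hD⟩ := exists_bound_phaseInt h.cont_v |t|
  rw [← oscInt_mul_intervalIntegral h2 h.cont_v, oscInt, oscInt, ← integral_const_mul,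
    ← integral_sub]
  · refine integral_congr_ae (ae_of_all _ fun ν => ?_)
    simp only [amp, profile, phaseInt]
    push_cast
    ring
  · refine h1.norm.mono' ?_ (ae_of_all _ fun ν => ?_)
    · exact (Continuous.aestronglyMeasurable (by fun_prop)).mul h1.1
    · rw [norm_mul, norm_exp_I_mul_mul, one_mul]
  · refine Integrable.const_mul ?_ _
    refine (h2.norm.mul_const D).mono' ?_ (ae_of_all _ fun ν => ?_)
    · have := continuous_phaseInt h.cont_v t
      exact (Continuous.aestronglyMeasurable (by fun_prop)).mul
        (h2.1.mul this.aestronglyMeasurable)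
    · rw [norm_mul, norm_exp_I_mul_mul, one_mul, norm_mul]
      exact mul_le_mul_of_nonneg_left ((hD t le_rfl).2 ν) (norm_nonneg _)

/-- The memory force vanishes at infinity when the velocity does. -/
theorem tendsto_functional {D : ℝ} (hD : ∀ t, |v t| ≤ D)
    (hZ : Integrable (oscInt fun ν => ((a ν ^ 2 : ℝ) : ℂ)))
    {l : Filter ℝ} [l.IsCountablyGenerated] (hl : l ≤ cocompact ℝ)
    (hl' : ∀ c : ℝ, Tendsto (fun t => t + c) l l) (hv : Tendsto v l (𝓝 0)) :
    Tendsto (fun t => ∫ ν, (a ν : ℂ) * amp a w₀ v t ν) l (𝓝 0) := by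
  set Z := oscInt fun ν => ((a ν ^ 2 : ℝ) : ℂ)
  have hcv := h.cont_v
  have h1 : Tendsto (oscInt fun ν => a ν * w₀ ν) l (𝓝 0) :=
    (tendsto_oscInt_cocompact _).mono_left hl
  -- After the substitution `u = t - s` the memory integral is majorised by one over the whole line,
  -- with dominating function `‖Z‖ D`; this serves both signs of `t`.
  have h2 : Tendsto (fun t => ∫ u, ‖Z u‖ * ‖v (t - u)‖) l (𝓝 (∫ _ : ℝ, (0 : ℝ))) := by
    refine tendsto_integral_filter_of_dominated_convergence (fun u => ‖Z u‖ * D)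
      (Eventually.of_forall fun t => ?_) (Eventually.of_forall fun t => ae_of_all _ fun u => ?_)
      (hZ.norm.mul_const D) (ae_of_all _ fun u => ?_)
    · exact hZ.norm.1.mul (Continuous.aestronglyMeasurable (by fun_prop))
    · rw [Real.norm_of_nonneg (by positivity)]
      exact mul_le_mul_of_nonneg_left (hD _) (norm_nonneg _)
    · simpa [sub_eq_add_neg] using ((hv.comp (hl' (-u))).norm).const_mul ‖Z u‖
  rw [integral_zero] at h2
  have h3 : Tendsto (fun t => Complex.I * ∫ s in (0 : ℝ)..t, Z (t - s) * v s) l (𝓝 0) := by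
    refine squeeze_zero_norm (fun t => ?_) h2
    rw [norm_mul, Complex.norm_I, one_mul,
      ← integral_sub_left_eq_self (fun u => ‖Z u‖ * ‖v (t - u)‖) volume t]
    refine intervalIntegral.norm_integral_le_integral_norm_uIoc.trans ?_
    have hi : Integrable fun s => ‖Z (t - s)‖ * ‖v (t - (t - s))‖ := by
      refine ((hZ.comp_sub_left t).norm.mul_const D).mono' ?_ (ae_of_all _ fun s => ?_)
      · exact (hZ.comp_sub_left t).norm.1.mul (Continuous.aestronglyMeasurable (by fun_prop))
      · rw [Real.norm_of_nonneg (by positivity)]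
        exact mul_le_mul_of_nonneg_left (hD _) (norm_nonneg _)
    refine le_trans (le_of_eq ?_) (setIntegral_le_integral (s := Set.uIoc 0 t) hi (ae_of_all _ fun s => by positivity))
    refine integral_congr_ae (ae_of_all _ fun s => ?_)
    simp
  rw [funext h.functional_eq]
  have h4 := h1.sub h3
  rw [sub_zero] at h4
  exact h4

omit h in
theorem lintegral_enorm_sq_le_of_integral_norm_sq {f : ℝ → ℂ} (hf : MemLp f 2 volume) {M : ℝ}
    (hM : ∫ ν, ‖f ν‖ ^ 2 ≤ M) : ∫⁻ ν, ‖f ν‖ₑ ^ 2 ≤ ENNReal.ofReal M := by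
  refine le_trans (le_of_eq ?_) (ENNReal.ofReal_le_ofReal hM)
  rw [ofReal_integral_eq_lintegral_ofReal (integrable_norm_sq_of_memLp hf)
    (ae_of_all _ fun _ => by positivity)]
  refine lintegral_congr fun ν => ?_
  rw [ENNReal.ofReal_pow (norm_nonneg _), ofReal_norm]

/-- Smoothing with a kernel whose Fourier transform is supported away from the zero of `a`. -/
theorem tendsto_smoothing {M D L : ℝ} (hM : ∀ t, ∫ ν, ‖amp a w₀ v t ν‖ ^ 2 ≤ M)
    (hD : ∀ t, |v t| ≤ D) (hL : ∀ s t, |v s - v t| ≤ L * |s - t|)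
    (ha : ∀ ν, ν ≠ 0 → a ν ≠ 0) {X : ℝ → ℂ} (hX : Continuous X) (hXs : HasCompactSupport X)
    {r : ℝ} (hr : 0 < r) (hXr : ∀ ν, |ν| < r → X ν = 0) (hk : Integrable (oscInt X))
    {l : Filter ℝ} [l.IsCountablyGenerated] (hl : l ≤ cocompact ℝ) :
    Tendsto (fun t => ∫ s, oscInt X (t - s) * v s) l (𝓝 0) := by
  have hcv := h.cont_v
  have hki : ∀ t, Integrable fun s => oscInt X (t - s) * v s := fun t => by
    refine ((hk.comp_sub_left t).norm.mul_const D).mono' ?_ (ae_of_all _ fun s => ?_)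
    · exact (hk.comp_sub_left t).1.mul (Continuous.aestronglyMeasurable (by fun_prop))
    · rw [norm_mul, Complex.norm_real]
      exact mul_le_mul_of_nonneg_left (hD _) (norm_nonneg _)
  have hXi : Integrable X := hX.integrable_of_hasCompactSupport hXs
  have hL0 : 0 ≤ L := by simpa using (abs_nonneg _).trans (hL 1 0)
  -- Division by `a` is harmless: on the support of `X` outside `|ν| < r`, a compact set, `|a|` is
  -- bounded below.
  obtain ⟨C, hC0, hC⟩ : ∃ C, 0 ≤ C ∧ ∀ ν, ‖X ν‖ ≤ C * |a ν| := by
    have hK : IsCompact (tsupport X ∩ {ν | r ≤ |ν|}) :=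
      hXs.isCompact.inter_right (isClosed_le continuous_const continuous_abs)
    have hcont : ContinuousOn (fun ν => ‖X ν‖ / |a ν|) (tsupport X ∩ {ν | r ≤ |ν|}) := by
      refine hX.norm.continuousOn.div h.cont_a.abs.continuousOn fun ν hν => ?_
      refine abs_ne_zero.2 (ha ν fun h0 => ?_)
      have := hν.2
      simp only [h0, Set.mem_ofPred_eq, abs_zero] at this
      linarith
    obtain ⟨C, hC⟩ := hK.exists_bound_of_continuousOn hcont
    refine ⟨|C|, abs_nonneg _, fun ν => ?_⟩
    by_cases h0 : X ν = 0
    · rw [h0, norm_zero]; positivity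
    · have hr' : r ≤ |ν| := not_lt.1 fun hlt => h0 (hXr ν hlt)
      have hpos : 0 < |a ν| := abs_pos.2 (ha ν (abs_pos.1 (hr.trans_le hr')))
      have := hC ν ⟨subset_tsupport _ h0, hr'⟩
      rw [Real.norm_of_nonneg (by positivity), div_le_iff₀ hpos] at this
      exact this.trans (mul_le_mul_of_nonneg_right (le_abs_self C) hpos.le)
  refine tendsto_zero_of_lintegral_sq ?_ ?_ hl
  · have hlip : LipschitzWith ((∫ s, ‖oscInt X s‖) * L).toNNReal
        (fun t => ∫ s, oscInt X (t - s) * v s) := by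
      refine LipschitzWith.of_dist_le_mul fun t t' => ?_
      have e : ∀ t, ∫ s, oscInt X (t - s) * v s = ∫ s, oscInt X s * v (t - s) := fun t => by
        rw [← integral_sub_left_eq_self _ volume t]
        simp
      have hki' : ∀ t, Integrable fun s => oscInt X s * v (t - s) := fun t => by
        simpa using (hki t).comp_sub_left t
      rw [dist_eq_norm, e, e, ← integral_sub (hki' _) (hki' _)]
      simp only [← mul_sub]
      rw [Real.coe_toNNReal _ (by positivity), mul_assoc, ← integral_mul_const]
      refine norm_integral_le_of_norm_le (hk.norm.mul_const _) (ae_of_all _ fun s => ?_)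
      rw [norm_mul]
      refine mul_le_mul_of_nonneg_left ?_ (norm_nonneg _)
      rw [← Complex.ofReal_sub, Complex.norm_real, Real.norm_eq_abs, dist_eq_norm, Real.norm_eq_abs]
      simpa using hL (t - s) (t' - s)
    exact hlip.uniformContinuous
  · set F : ℕ → ℝ → ℂ := fun n ν =>
      X ν * ∫ s in (-(n : ℝ))..n, Complex.exp (-(Complex.I * ν * s)) * v s with hF
    have hFc : ∀ n, Continuous (F n) := fun n =>
      hX.mul (intervalIntegral.continuous_parametric_intervalIntegral_of_continuous'
        (by fun_prop) _ _)
    have hFs : ∀ n, HasCompactSupport (F n) := fun n => hXs.mul_right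
    have hFi : ∀ n, Integrable (F n) := fun n => (hFc n).integrable_of_hasCompactSupport (hFs n)
    have hF2 : ∀ n, MemLp (F n) 2 volume := fun n => (hFc n).memLp_of_hasCompactSupport (hFs n)
    have hosc : ∀ n t, oscInt (F n) t = ∫ s in (-(n : ℝ))..n, oscInt X (t - s) * v s := fun n t =>
      oscInt_mul_intervalIntegral hXi h.cont_v _ _ t
    have hbound : ∀ n, ∫⁻ t, ‖oscInt (F n) t‖ₑ ^ 2 ≤
        ENNReal.ofReal (2 * Real.pi) * ENNReal.ofReal (C ^ 2 * (4 * M)) := fun n => by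
      rw [lintegral_enorm_oscInt_sq (hFi n) (hF2 n)]
      gcongr
      refine lintegral_enorm_sq_le_of_integral_norm_sq (hF2 n) ?_
      have hle : ∀ ν, ‖F n ν‖ ^ 2 ≤
          C ^ 2 * (2 * ‖amp a w₀ v n ν‖ ^ 2 + 2 * ‖amp a w₀ v (-n) ν‖ ^ 2) := fun ν => by
        -- The energy bound enters here: `a` times the truncated transform is a difference of two
        -- profiles, each of squared norm at most `M`. Expanding the square of the sum costs a
        -- factor `2`, whence `4 * M`.
        have e : ‖profile a w₀ v (-n) ν - profile a w₀ v n ν‖ =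
            |a ν| * ‖∫ s in (-(n : ℝ))..n, Complex.exp (-(Complex.I * ν * s)) * v s‖ := by
          have : profile a w₀ v (-n) ν - profile a w₀ v n ν =
              Complex.I * a ν * (phaseInt v n ν - phaseInt v (-n) ν) := by
            simp only [profile]; ring
          rw [this, phaseInt, phaseInt, intervalIntegral.integral_interval_sub_left
            ((continuous_phase_mul h.cont_v ν).intervalIntegrable _ _)
            ((continuous_phase_mul h.cont_v ν).intervalIntegrable _ _), norm_mul, norm_mul,
            Complex.norm_I, one_mul, Complex.norm_real, Real.norm_eq_abs]
        have h1 : ‖F n ν‖ ≤ C * (‖amp a w₀ v n ν‖ + ‖amp a w₀ v (-n) ν‖) := by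
          rw [hF]
          simp only [norm_mul]
          calc _ ≤ (C * |a ν|) * ‖∫ s in (-(n : ℝ))..n, Complex.exp (-(Complex.I * ν * s)) * v s‖ :=
                mul_le_mul_of_nonneg_right (hC ν) (norm_nonneg _)
            _ = C * ‖profile a w₀ v (-n) ν - profile a w₀ v n ν‖ := by rw [e, mul_assoc]
            _ ≤ _ := by
              refine mul_le_mul_of_nonneg_left ?_ hC0
              rw [norm_amp, norm_amp, add_comm]
              exact norm_sub_le _ _
        calc ‖F n ν‖ ^ 2 ≤ (C * (‖amp a w₀ v n ν‖ + ‖amp a w₀ v (-n) ν‖)) ^ 2 :=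
              pow_le_pow_left₀ (norm_nonneg _) h1 2
          _ ≤ _ := by
            rw [mul_pow]
            refine mul_le_mul_of_nonneg_left ?_ (sq_nonneg C)
            nlinarith [sq_nonneg (‖amp a w₀ v n ν‖ - ‖amp a w₀ v (-n) ν‖)]
      have hi : ∀ t, Integrable fun ν => ‖amp a w₀ v t ν‖ ^ 2 := fun t =>
        integrable_norm_sq_of_memLp (h.memLp_amp t)
      refine (integral_mono (integrable_norm_sq_of_memLp (hF2 n))
        ((((hi n).const_mul 2).add ((hi (-n)).const_mul 2)).const_mul (C ^ 2)) hle).trans ?_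
      simp only [Pi.add_apply]
      rw [integral_const_mul, integral_add ((hi n).const_mul 2) ((hi (-n)).const_mul 2),
        integral_const_mul, integral_const_mul]
      refine mul_le_mul_of_nonneg_left ?_ (sq_nonneg C)
      linarith [hM n, hM (-n)]
    have hlim : ∀ t, Tendsto (fun n => ‖oscInt (F n) t‖ₑ ^ 2) atTop
        (𝓝 (‖∫ s, oscInt X (t - s) * v s‖ₑ ^ 2)) := fun t => by
      simp only [hosc]
      have := intervalIntegral_tendsto_integral (hki t)
        (tendsto_neg_atTop_atBot.comp (tendsto_natCast_atTop_atTop (R := ℝ)))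
        (tendsto_natCast_atTop_atTop (R := ℝ))
      exact ((ENNReal.continuous_pow 2).tendsto _).comp this.enorm
    -- The truncated convolutions converge pointwise, so Fatou's lemma passes their uniform `L²`
    -- bound to the limit.
    have hfatou := lintegral_liminf_le (μ := volume) (u := atTop)
      (f := fun (n : ℕ) t => ‖oscInt (F n) t‖ₑ ^ 2)
      (fun n => (continuous_enorm.comp (continuous_oscInt (hFi n))).measurable.pow_const 2)
    rw [lintegral_congr fun t => (hlim t).liminf_eq] at hfatou
    have hfin : ENNReal.ofReal (2 * Real.pi) * ENNReal.ofReal (C ^ 2 * (4 * M)) ≠ ⊤ :=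
      ENNReal.mul_ne_top ENNReal.ofReal_ne_top ENNReal.ofReal_ne_top
    refine ne_top_of_le_ne_top hfin (hfatou.trans ?_)
    exact liminf_le_of_le (by isBoundedDefault) fun b hb => by
      obtain ⟨n, hn⟩ := hb.exists
      exact hn.trans (hbound n)

end AmpData

/-! ### Mollification at high and low frequencies -/

theorem oscInt_comp_mul (f : ℝ → ℂ) {c : ℝ} (hc : 0 < c) (t : ℝ) :
    oscInt (fun ν => f (c⁻¹ * ν)) t = c * oscInt f (c * t) := by
  have := Measure.integral_comp_mul_left
    (fun x : ℝ => Complex.exp (Complex.I * x * (c * t : ℝ)) * f x) c⁻¹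
  rw [inv_inv, abs_of_pos hc, Complex.real_smul] at this
  rw [oscInt, oscInt, ← this]
  refine integral_congr_ae (ae_of_all _ fun ν => ?_)
  have hc' : (c : ℂ) ≠ 0 := by exact_mod_cast hc.ne'
  simp only
  congr 2
  push_cast
  field_simp

open FourierTransform in
-- Since `χ = 1` near `0`, the kernel has integral one, and the multipliers of two of its dilates
-- cancel near frequency `0`. Their difference is an admissible multiplier for
-- `AmpData.tendsto_smoothing`.
theorem exists_mollifier : ∃ (χ : ℝ → ℂ) (S : SchwartzMap ℝ ℂ), Continuous χ ∧
    HasCompactSupport χ ∧ (∀ x, |x| ≤ 1 → χ x = 1) ∧ ∫ x, S x = 1 ∧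
      ∀ s, S s = oscInt χ (2 * Real.pi * s) := by
  let B : ContDiffBump (0 : ℝ) := ⟨1, 2, one_pos, one_lt_two⟩
  have hg' : ContDiff ℝ ∞ (fun x => (B x : ℂ)) := Complex.ofRealCLM.contDiff.comp B.contDiff
  have hgs' : HasCompactSupport (fun x => (B x : ℂ)) :=
    B.hasCompactSupport.comp_left (g := fun x : ℝ => (x : ℂ)) Complex.ofReal_zero
  let G : SchwartzMap ℝ ℂ := hgs'.toSchwartzMap hg'
  have hone : ∀ x : ℝ, |x| ≤ 1 → (B x : ℂ) = 1 := fun x hx => by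
    rw [B.one_of_mem_closedBall (by simpa [B] using hx), Complex.ofReal_one]
  refine ⟨fun x => (B x : ℂ), 𝓕⁻ G, hg'.continuous, hgs', hone, ?_, fun s => ?_⟩
  · have h1 : 𝓕 (𝓕⁻ G) 0 = G 0 := by rw [FourierTransform.fourier_fourierInv_eq]
    rw [SchwartzMap.fourier_coe, Real.fourier_real_eq_integral_exp_smul] at h1
    have h2 : G 0 = 1 := hone 0 (by simp)
    rw [h2] at h1
    simpa using h1
  · rw [SchwartzMap.fourierInv_coe, Real.fourierInv_eq', oscInt]
    refine integral_congr_ae (ae_of_all _ fun ν => ?_)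
    change _ • (B ν : ℂ) = _
    rw [smul_eq_mul]
    congr 2
    simp only [RCLike.inner_apply, conj_trivial]
    push_cast
    ring

section Mollify

variable (S : SchwartzMap ℝ ℂ) {v q : ℝ → ℝ} {ρ : ℝ}

theorem integrable_mollifier_mul (hρ : 0 < ρ) {f : ℝ → ℂ} (hf : Continuous f) {D : ℝ}
    (hD : ∀ t, ‖f t‖ ≤ D) (t : ℝ) : Integrable fun s => (ρ * S (ρ * (t - s))) * f s := by
  have h1 : Integrable fun s => S (ρ * (t - s)) :=
    ((S.integrable (μ := volume)).comp_mul_left' hρ.ne').comp_sub_left t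
  have h2 : Integrable fun s => ρ * S (ρ * (t - s)) := h1.const_mul _
  refine (h2.norm.mul_const D).mono' (h2.1.mul hf.aestronglyMeasurable) (ae_of_all _ fun s => ?_)
  rw [norm_mul]
  exact mul_le_mul_of_nonneg_left (hD s) (norm_nonneg _)

/-- High frequencies: averaging a Lipschitz function at scale `1/ρ` moves it by at most the
Lipschitz constant times the first moment of the kernel, divided by `ρ`. -/
theorem norm_mollify_sub_le (h1 : ∫ x, S x = 1) (hρ : 0 < ρ) (hv : Continuous v) {D L : ℝ}
    (hD : ∀ t, |v t| ≤ D) (hL : ∀ s t, |v s - v t| ≤ L * |s - t|) (t : ℝ) :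
    ‖(∫ s, (ρ * S (ρ * (t - s))) * v s) - v t‖ ≤ L * (∫ x, ‖x‖ ^ 1 * ‖S x‖) / ρ := by
  have hρ' : (ρ : ℂ) ≠ 0 := by exact_mod_cast hρ.ne'
  have hi := integrable_mollifier_mul S hρ (f := fun s => (v s : ℂ)) (by fun_prop)
    (D := D) (fun s => by rw [Complex.norm_real]; exact hD s) t
  have hi' := integrable_mollifier_mul S hρ (f := fun _ => (v t : ℂ)) (by fun_prop)
    (D := D) (fun s => by rw [Complex.norm_real]; exact hD t) t
  have e1 : ∫ s, (ρ * S (ρ * (t - s))) * (v t : ℂ) = v t := by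
    rw [integral_mul_const, integral_const_mul,
      integral_sub_left_eq_self (fun u => S (ρ * u)) volume t, Measure.integral_comp_mul_left, h1,
      abs_of_pos (by positivity), Complex.real_smul]
    push_cast
    field_simp
  have hb : ∀ s, ‖(ρ * S (ρ * (t - s))) * (v s : ℂ) - (ρ * S (ρ * (t - s))) * (v t : ℂ)‖ ≤
      L * (‖ρ * (t - s)‖ ^ 1 * ‖S (ρ * (t - s))‖) := fun s => by
    rw [← mul_sub, norm_mul, norm_mul, ← Complex.ofReal_sub, Complex.norm_real, Complex.norm_real,
      pow_one, norm_mul, Real.norm_eq_abs (v s - v t), Real.norm_eq_abs (t - s)]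
    have := hL s t
    rw [abs_sub_comm s t] at this
    nlinarith [mul_nonneg (norm_nonneg ρ) (norm_nonneg (S (ρ * (t - s))))]
  have hSi : Integrable fun x : ℝ => ‖x‖ ^ 1 * ‖S x‖ := S.integrable_pow_mul volume 1
  have hbi : Integrable fun s => L * (‖ρ * (t - s)‖ ^ 1 * ‖S (ρ * (t - s))‖) :=
    ((hSi.comp_mul_left' hρ.ne').comp_sub_left t).const_mul L
  have := norm_integral_le_of_norm_le hbi (ae_of_all _ hb)
  rw [integral_sub hi hi', e1] at this
  refine this.trans_eq ?_
  rw [integral_const_mul,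
    integral_sub_left_eq_self (fun u => ‖ρ * u‖ ^ 1 * ‖S (ρ * u)‖) volume t,
    Measure.integral_comp_mul_left (fun x => ‖x‖ ^ 1 * ‖S x‖) ρ, abs_of_pos (by positivity),
    smul_eq_mul]
  field_simp

/-- Low frequencies: integration by parts moves the derivative from `q` to the kernel, which gains a
factor `ρ`. -/
theorem norm_mollify_deriv_le (hρ : 0 < ρ) (hv : Continuous v) {D Q : ℝ}
    (hD : ∀ t, |v t| ≤ D) (hq : ∀ t, HasDerivAt q (v t) t) (hQ : ∀ t, |q t| ≤ Q) (t : ℝ) :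
    ‖∫ s, (ρ * S (ρ * (t - s))) * v s‖ ≤ ρ * (Q * ∫ x, ‖deriv S x‖) := by
  have hqc : Continuous q := continuous_iff_continuousAt.2 fun t => (hq t).continuousAt
  have hi := integrable_mollifier_mul S hρ (f := fun s => (v s : ℂ)) (by fun_prop)
    (D := D) (fun s => by rw [Complex.norm_real]; exact hD s) t
  have hi' := integrable_mollifier_mul S hρ (f := fun s => (q s : ℂ)) (by fun_prop)
    (D := Q) (fun s => by rw [Complex.norm_real]; exact hQ s) t
  have hSi : Integrable (deriv S) := (SchwartzMap.derivCLM ℂ ℂ S).integrable (μ := volume)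
  have hder : ∀ s, HasDerivAt (fun s : ℝ => (ρ * S (ρ * (t - s)) : ℂ))
      (-(ρ * (ρ * deriv S (ρ * (t - s))))) s := fun s => by
    have h1 : HasDerivAt (fun s : ℝ => ρ * (t - s)) (-ρ) s := by
      simpa using ((hasDerivAt_id s).const_sub t).const_mul ρ
    have h2 := ((S.differentiable (ρ * (t - s))).hasDerivAt.scomp s h1).const_mul (ρ : ℂ)
    refine h2.congr_deriv ?_
    rw [Complex.real_smul]
    push_cast
    ring
  have hbi : Integrable fun s => Q * (ρ * (ρ * ‖deriv S (ρ * (t - s))‖)) :=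
    ((((hSi.norm.comp_mul_left' hρ.ne').comp_sub_left t).const_mul ρ).const_mul ρ).const_mul Q
  have hb : ∀ s, ‖-(ρ * (ρ * deriv S (ρ * (t - s)))) * (q s : ℂ)‖ ≤
      Q * (ρ * (ρ * ‖deriv S (ρ * (t - s))‖)) := fun s => by
    rw [norm_mul, norm_neg, norm_mul, norm_mul, Complex.norm_real, Complex.norm_real,
      Real.norm_of_nonneg hρ.le, mul_comm]
    exact mul_le_mul_of_nonneg_right (hQ s) (by positivity)
  have hi2 : Integrable fun s => -(ρ * (ρ * deriv S (ρ * (t - s)))) * (q s : ℂ) := by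
    refine hbi.mono' (AEStronglyMeasurable.mul ?_ ?_) (ae_of_all _ hb)
    · exact ((((hSi.comp_mul_left' hρ.ne').comp_sub_left t).const_mul (ρ : ℂ)).const_mul
        (ρ : ℂ)).neg.1
    · exact Continuous.aestronglyMeasurable (by fun_prop)
  have key := integral_mul_deriv_eq_deriv_mul_of_integrable
    (u := fun s => (ρ * S (ρ * (t - s)) : ℂ)) (v := fun s => (q s : ℂ)) (v' := fun s => (v s : ℂ))
    (fun s _ => hder s) (fun s _ => (hq s).ofReal_comp) hi hi2 hi'
  rw [key, norm_neg]
  refine (norm_integral_le_of_norm_le hbi (ae_of_all _ hb)).trans_eq ?_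
  rw [integral_const_mul, integral_const_mul, integral_const_mul,
    integral_sub_left_eq_self (fun u => ‖deriv S (ρ * u)‖) volume t,
    Measure.integral_comp_mul_left (fun x => ‖deriv S x‖) ρ, abs_of_pos (by positivity),
    smul_eq_mul]
  field_simp

end Mollify

/-- The velocity of a particle that drives a thermostat with a nondegenerate coupling vanishes at
infinity, if the energy of the thermostat stays bounded. -/
theorem AmpData.tendsto_velocity {a : ℝ → ℝ} {w₀ : ℝ → ℂ} {v q : ℝ → ℝ} (h : AmpData a w₀ v)
    {M D L Q : ℝ} (hM : ∀ t, ∫ ν, ‖amp a w₀ v t ν‖ ^ 2 ≤ M)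
    (hD : ∀ t, |v t| ≤ D) (hL : ∀ s t, |v s - v t| ≤ L * |s - t|)
    (hq : ∀ t, HasDerivAt q (v t) t) (hQ : ∀ t, |q t| ≤ Q)
    (ha : ∀ ν, ν ≠ 0 → a ν ≠ 0)
    {l : Filter ℝ} [l.IsCountablyGenerated] (hl : l ≤ cocompact ℝ) : Tendsto v l (𝓝 0) := by
  obtain ⟨χ, S, hχ, hχs, hχ1, hS1, hSχ⟩ := exists_mollifier
  have hpi : 0 < 2 * Real.pi := by positivity
  have hpi' : (2 * Real.pi : ℂ) ≠ 0 := by exact_mod_cast hpi.ne'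
  have hv := h.cont_v
  have hosc : ∀ ρ, 0 < ρ → ∀ s, oscInt (fun ν => χ ((2 * Real.pi * ρ)⁻¹ * ν)) s =
      2 * Real.pi * (ρ * S (ρ * s)) := fun ρ hρ s => by
    rw [oscInt_comp_mul χ (by positivity), hSχ]
    push_cast
    ring_nf
  have hc : ∀ ρ, Continuous fun ν => χ ((2 * Real.pi * ρ)⁻¹ * ν) := fun ρ => by fun_prop
  have hcs : ∀ ρ, 0 < ρ → HasCompactSupport fun ν => χ ((2 * Real.pi * ρ)⁻¹ * ν) := fun ρ hρ =>
    hχs.comp_homeomorph (Homeomorph.mulLeft₀ (2 * Real.pi * ρ)⁻¹ (by positivity))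
  have hosub : ∀ ρ₁ ρ₂, 0 < ρ₁ → 0 < ρ₂ → ∀ s, oscInt (fun ν => χ ((2 * Real.pi * ρ₂)⁻¹ * ν) -
      χ ((2 * Real.pi * ρ₁)⁻¹ * ν)) s =
      2 * Real.pi * (ρ₂ * S (ρ₂ * s) - ρ₁ * S (ρ₁ * s)) := fun ρ₁ ρ₂ h₁ h₂ s => by
    have hi : ∀ ρ, 0 < ρ → Integrable fun ν : ℝ =>
        Complex.exp (Complex.I * ν * s) * χ ((2 * Real.pi * ρ)⁻¹ * ν) := fun ρ hρ => by
      refine ((hc ρ).integrable_of_hasCompactSupport (hcs ρ hρ)).norm.mono'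
        (Continuous.aestronglyMeasurable (by fun_prop)) (ae_of_all _ fun ν => ?_)
      rw [norm_mul, norm_exp_I_mul_mul, one_mul]
    rw [mul_sub, ← hosc ρ₁ h₁, ← hosc ρ₂ h₂, oscInt, oscInt, oscInt,
      ← integral_sub (hi ρ₂ h₂) (hi ρ₁ h₁)]
    simp only [mul_sub]
  -- The difference of the two mollifications is a band-pass filter: both multipliers equal one for
  -- `|ν| < 2πρ₁`.
  have hmid : ∀ ρ₁ ρ₂, 0 < ρ₁ → ρ₁ ≤ ρ₂ → Tendsto (fun t =>
      (∫ s, (ρ₂ * S (ρ₂ * (t - s))) * v s) - ∫ s, (ρ₁ * S (ρ₁ * (t - s))) * (v s : ℂ)) l (𝓝 0) := by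
    intro ρ₁ ρ₂ h₁ h₁₂
    have h₂ : 0 < ρ₂ := h₁.trans_le h₁₂
    have hiS : ∀ ρ, 0 < ρ → Integrable fun s => ρ * S (ρ * s) := fun ρ hρ =>
      ((S.integrable (μ := volume)).comp_mul_left' hρ.ne').const_mul _
    have key := h.tendsto_smoothing (X := fun ν => χ ((2 * Real.pi * ρ₂)⁻¹ * ν) -
      χ ((2 * Real.pi * ρ₁)⁻¹ * ν)) (r := 2 * Real.pi * ρ₁) hM hD hL ha ((hc ρ₂).sub (hc ρ₁))
      ((hcs ρ₂ h₂).sub (hcs ρ₁ h₁)) (by positivity) (fun ν hν => ?_) ?_ hl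
    · have key2 := key.const_mul (2 * Real.pi : ℂ)⁻¹
      rw [mul_zero] at key2
      refine key2.congr fun t => ?_
      rw [← integral_sub
        (integrable_mollifier_mul S h₂ (f := fun s => (v s : ℂ)) (by fun_prop)
          (D := D) (fun s => by rw [Complex.norm_real]; exact hD s) t)
        (integrable_mollifier_mul S h₁ (f := fun s => (v s : ℂ)) (by fun_prop)
          (D := D) (fun s => by rw [Complex.norm_real]; exact hD s) t), ← integral_const_mul]
      refine integral_congr_ae (ae_of_all _ fun s => ?_)
      simp only [hosub ρ₁ ρ₂ h₁ h₂]
      field_simp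
    · have hle : ∀ ρ, ρ₁ ≤ ρ → χ ((2 * Real.pi * ρ)⁻¹ * ν) = 1 := fun ρ hρ => by
        have hρ0 : 0 < ρ := h₁.trans_le hρ
        refine hχ1 _ ?_
        rw [abs_mul, abs_of_pos (by positivity), inv_mul_le_iff₀ (by positivity), mul_one]
        refine hν.le.trans ?_
        gcongr
      simp only [hle ρ₁ le_rfl, hle ρ₂ h₁₂, sub_self]
    · rw [funext (hosub ρ₁ ρ₂ h₁ h₂)]
      exact ((hiS ρ₂ h₂).sub (hiS ρ₁ h₁)).const_mul _
  rw [Metric.tendsto_nhds]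
  intro ε hε
  have hA : 0 ≤ ∫ x, ‖x‖ ^ 1 * ‖S x‖ := integral_nonneg fun _ => by positivity
  have hB : 0 ≤ ∫ x, ‖deriv S x‖ := integral_nonneg fun _ => norm_nonneg _
  have hL0 : 0 ≤ L := by simpa using (abs_nonneg _).trans (hL 1 0)
  have hQ0 : 0 ≤ Q := (abs_nonneg _).trans (hQ 0)
  set A := L * ∫ x, ‖x‖ ^ 1 * ‖S x‖ with hAdef
  set B := Q * ∫ x, ‖deriv S x‖ with hBdef
  have hA0 : 0 ≤ A := mul_nonneg hL0 hA
  have hB0 : 0 ≤ B := mul_nonneg hQ0 hB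
  -- `ρ₁` makes the low-frequency part smaller than `ε/3`, and `ρ₂` below does the same for the
  -- high-frequency part. The `+ 1` allows for vanishing `A` or `B`; the cutoffs at `1` give `ρ₁ ≤
  -- ρ₂`.
  obtain ⟨ρ₁, h₁, hρ₁1, hρ₁⟩ : ∃ ρ₁ : ℝ, 0 < ρ₁ ∧ ρ₁ ≤ 1 ∧ ρ₁ * B < ε / 3 := by
    refine ⟨min 1 (ε / (3 * (B + 1))), by positivity, min_le_left _ _, ?_⟩
    calc min 1 (ε / (3 * (B + 1))) * B ≤ ε / (3 * (B + 1)) * B := by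
          gcongr; exact min_le_right _ _
      _ < ε / (3 * (B + 1)) * (B + 1) := by
          have : 0 < ε / (3 * (B + 1)) := by positivity
          nlinarith
      _ = ε / 3 := by field_simp
  obtain ⟨ρ₂, h₂1, hρ₂⟩ : ∃ ρ₂ : ℝ, 1 ≤ ρ₂ ∧ A / ρ₂ < ε / 3 := by
    refine ⟨max 1 (3 * (A + 1) / ε), le_max_left _ _, ?_⟩
    rw [div_lt_iff₀ (by positivity)]
    calc A < ε / 3 * (3 * (A + 1) / ε) := by field_simp; linarith
      _ ≤ _ := by gcongr; exact le_max_right _ _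
  have h₂ : 0 < ρ₂ := one_pos.trans_le h₂1
  filter_upwards [Metric.tendsto_nhds.1 (hmid ρ₁ ρ₂ h₁ (hρ₁1.trans h₂1)) (ε / 3) (by positivity)]
    with t ht
  have b1 := norm_mollify_sub_le S hS1 h₂ hv hD hL t
  have b2 := norm_mollify_deriv_le S h₁ hv hD hq hQ t
  rw [dist_zero_right] at ht ⊢
  rw [← Complex.norm_real]
  set I₁ := ∫ s, (ρ₁ * S (ρ₁ * (t - s))) * (v s : ℂ)
  set I₂ := ∫ s, (ρ₂ * S (ρ₂ * (t - s))) * (v s : ℂ)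
  calc ‖(v t : ℂ)‖ = ‖-(I₂ - v t) + (I₂ - I₁) + I₁‖ := by congr 1; ring
    _ ≤ ‖I₂ - v t‖ + ‖I₂ - I₁‖ + ‖I₁‖ := by
      refine (norm_add_le _ _).trans (add_le_add_left ((norm_add_le _ _).trans ?_) _)
      rw [norm_neg]
    _ < ε := by linarith

/-! ### Regularity of linear functionals of the amplitude -/

/-- Each derivative exchanges the weight `c i` for `c (i + 1)` and produces a multiple of `v`. Hence
`n` derivatives consume `n` further moments but only `n - 1` derivatives of `v`; this gain of one is
what lets the bootstrap run. -/
theorem AmpData.cbReg_functional {a : ℝ → ℝ} {w₀ : ℝ → ℂ} {v : ℝ → ℝ} (h : AmpData a w₀ v)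
    {M D : ℝ} (hM : ∀ t, ∫ ν, ‖amp a w₀ v t ν‖ ^ 2 ≤ M) (hD : ∀ t, |v t| ≤ D) {c : ℕ → ℝ → ℂ} {R : ℕ}
    (hc : ∀ i ≤ R, MemLp (c i) 2 volume) (hcs : ∀ i ν, c (i + 1) ν = ν * c i ν)
    {n i : ℕ} (hin : i + n ≤ R) (hv : CbReg (n - 1) v) :
    CbReg n (fun t => ∫ ν, c i ν * amp a w₀ v t ν) := by
  induction n generalizing i with
  | zero => exact h.functional_mem_Cb (hc i (by omega)) hM hD
  | succ n ih =>
    have hc' : MemLp (fun ν => ν * c i ν) 2 volume := by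
      rw [← funext (hcs i)]; exact hc (i + 1) (by omega)
    refine CbReg.of_hasDerivAt (h.functional_mem_Cb (hc i (by omega)) hM hD)
      (fun t => h.hasDerivAt_functional (hc i (by omega)) hc' t) ?_
    have h1 := (ih (i := i + 1) (by omega) (hv.mono (by omega))).clm
      (ContinuousLinearMap.mul ℝ ℂ Complex.I)
    have h2 := (CbReg.clm Complex.ofRealCLM (show CbReg n v from hv)).clm
      (ContinuousLinearMap.mul ℝ ℂ (-(Complex.I * ∫ ν, c i ν * a ν)))
    have h3 := h1.add h2
    simp only [ContinuousLinearMap.mul_apply', Complex.ofRealCLM_apply, hcs, neg_mul,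
      ← sub_eq_add_neg] at h3
    exact h3

/-! ### Thermostats -/

theorem memLp_of_thermostatEnergy {x x' : ℝ → ℝ} (hx : AEMeasurable x) (hx' : AEMeasurable x')
    (h : thermostatEnergy x x' < ⊤) :
    MemLp (fun ν => ν * x ν) 2 volume ∧ MemLp x' 2 volume := by
  have key : ∀ f : ℝ → ℝ, AEMeasurable f → (∀ ν, f ν ^ 2 ≤ x' ν ^ 2 + ν ^ 2 * x ν ^ 2) →
      MemLp f 2 volume := fun f hf hle => by
    rw [memLp_two_iff_integrable_sq hf.aestronglyMeasurable]
    refine ⟨(hf.pow_const 2).aestronglyMeasurable, ?_⟩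
    rw [hasFiniteIntegral_iff_ofReal (ae_of_all _ fun _ => sq_nonneg _)]
    refine lt_of_le_of_lt (lintegral_mono (g := fun ν =>
      2 * ENNReal.ofReal ((x' ν ^ 2 + ν ^ 2 * x ν ^ 2) / 2)) fun ν => ?_) ?_
    · have : (2 : ℝ≥0∞) = ENNReal.ofReal 2 := by simp
      simp only
      rw [this, ← ENNReal.ofReal_mul zero_le_two]
      exact ENNReal.ofReal_le_ofReal (by linarith [hle ν])
    · rw [lintegral_const_mul' _ _ (by simp)]
      exact ENNReal.mul_lt_top (by simp) h
  refine ⟨key _ (aemeasurable_id.mul hx) fun ν => ?_, key _ hx' fun ν => ?_⟩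
  · rw [mul_pow]; nlinarith [sq_nonneg (x' ν)]
  · nlinarith [mul_nonneg (sq_nonneg ν) (sq_nonneg (x ν))]

/-- The complex amplitude of an oscillator with position `x` and velocity `x'`, measured from its
instantaneous equilibrium. -/
def initAmp (κ x x' : ℝ → ℝ) (y ν : ℝ) : ℂ := x' ν + Complex.I * ((ν * x ν - quot κ ν * y : ℝ) : ℂ)

theorem memLp_initAmp {κ x x' : ℝ → ℝ} (hκ : MemLp (quot κ) 2 volume)
    (hx : MemLp (fun ν => ν * x ν) 2 volume) (hx' : MemLp x' 2 volume) (y : ℝ) :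
    MemLp (initAmp κ x x' y) 2 volume := by
  have h1 : MemLp (fun ν => (x' ν : ℂ)) 2 volume := hx'.ofReal
  have h2 : MemLp (fun ν => quot κ ν * y) 2 volume := by
    simpa only [mul_comm] using hκ.const_mul y
  have h3 : MemLp (fun ν => ν * x ν - quot κ ν * y) 2 volume := hx.sub h2
  have h4 : MemLp (fun ν => ((ν * x ν - quot κ ν * y : ℝ) : ℂ)) 2 volume := h3.ofReal
  exact h1.add (h4.const_mul Complex.I)

/-- Uniqueness by an integrating factor: in the rotating frame the true amplitude and the Duhamel
expression have the same derivative and the same initial value. Writing `κ = ν a` avoids any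
division by `ν`. -/
theorem amp_eq_of_solution {κ : ℝ → ℝ} (hκ : ContDiff ℝ 2 κ) (h0 : κ 0 = 0) {x x' : ℝ → ℝ}
    {q v : ℝ → ℝ} (hq : ∀ t, HasDerivAt q (v t) t) (hv : Continuous v) {ν : ℝ} {X : ℝ → ℝ}
    (hX : Differentiable ℝ X)
    (hX' : ∀ t, HasDerivAt (deriv X) (-ν ^ 2 * X t + κ ν * q t) t)
    (hx : X 0 = x ν) (hx' : deriv X 0 = x' ν) (t : ℝ) :
    amp (quot κ) (initAmp κ x x' (q 0)) v t ν =
      deriv X t + Complex.I * ((ν * X t - quot κ ν * q t : ℝ) : ℂ) := by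
  set a := quot κ
  have hκν : (κ ν : ℂ) = ν * a ν := by rw [← Complex.ofReal_mul, mul_quot hκ h0]
  have hd : ∀ t : ℝ, HasDerivAt (fun t : ℝ => Complex.exp (-(Complex.I * ν * t)) *
      (deriv X t + Complex.I * ((ν * X t - a ν * q t : ℝ) : ℂ)) -
      profile a (initAmp κ x x' (q 0)) v t ν) 0 t := fun t => by
    have h1 : HasDerivAt (fun t : ℝ => Complex.exp (-(Complex.I * ν * t)))
        (Complex.exp (-(Complex.I * ν * t)) * (-(Complex.I * ν))) t := by
      have := (((hasDerivAt_id t).ofReal_comp).const_mul (Complex.I * ν)).neg.cexp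
      simpa using this
    have h2 := (((hX t).hasDerivAt.const_mul ν).sub
      ((hq t).const_mul (a ν))).ofReal_comp.const_mul Complex.I
    have h3 := (h1.mul ((hX' t).ofReal_comp.add h2)).sub
      (AmpData.hasDerivAt_profile (a := a) (w₀ := initAmp κ x x' (q 0)) hv t ν)
    refine h3.congr_deriv ?_
    simp only [Pi.add_apply, Pi.sub_apply]
    push_cast
    rw [hκν]
    linear_combination (-ν ^ 2 * X t + ν * a ν * q t) *
      Complex.exp (-(Complex.I * ν * t)) * Complex.I_sq
  have hconst := is_const_of_deriv_eq_zero (fun t => (hd t).differentiableAt)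
    (fun t => (hd t).deriv) t 0
  have hz : profile a (initAmp κ x x' (q 0)) v 0 ν =
      deriv X 0 + Complex.I * ((ν * X 0 - a ν * q 0 : ℝ) : ℂ) := by
    simp [profile, phaseInt, initAmp, hx, hx', a]
  simp only [hz, Complex.ofReal_zero, mul_zero, neg_zero, Complex.exp_zero, one_mul, sub_self] at hconst
  rw [amp, ← sub_eq_zero.1 hconst, ← mul_assoc, ← Complex.exp_add, add_neg_cancel, Complex.exp_zero,
    one_mul]

/-- The force exerted by a thermostat in terms of the amplitude. -/
theorem integrable_and_integral_force {κ : ℝ → ℝ} (hκ : ContDiff ℝ 2 κ) (h0 : κ 0 = 0)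
    {x x' q v : ℝ → ℝ} (h : AmpData (quot κ) (initAmp κ x x' (q 0)) v)
    (hq : ∀ t, HasDerivAt q (v t) t) {ξ : ℝ → ℝ → ℝ} (hξ : ∀ᵐ ν, Differentiable ℝ (ξ ν))
    (hξ' : ∀ᵐ ν, ∀ t, HasDerivAt (deriv (ξ ν)) (-ν ^ 2 * ξ ν t + κ ν * q t) t)
    (hx : ∀ᵐ ν, ξ ν 0 = x ν) (hx' : ∀ᵐ ν, deriv (ξ ν) 0 = x' ν) (t : ℝ) :
    Integrable (fun ν => κ ν * ξ ν t) ∧ ∫ ν, κ ν * ξ ν t =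
      (∫ ν, (quot κ ν : ℂ) * amp (quot κ) (initAmp κ x x' (q 0)) v t ν).im +
        (∫ ν, quot κ ν ^ 2) * q t := by
  have hi : Integrable fun ν => (quot κ ν : ℂ) * amp (quot κ) (initAmp κ x x' (q 0)) v t ν :=
    h.memLp_a.ofReal.integrable_mul (h.memLp_amp t)
  have e : (fun ν => κ ν * ξ ν t) =ᵐ[volume] fun ν =>
      ((quot κ ν : ℂ) * amp (quot κ) (initAmp κ x x' (q 0)) v t ν).im + quot κ ν ^ 2 * q t := by
    filter_upwards [hξ, hξ', hx, hx'] with ν h1 h2 h3 h4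
    rw [amp_eq_of_solution hκ h0 hq h.cont_v h1 h2 h3 h4, ← mul_quot hκ h0 ν]
    simp
    ring
  have hi2 : Integrable fun ν => quot κ ν ^ 2 * q t := h.memLp_a.integrable_sq.mul_const _
  refine ⟨(hi.im.add hi2).congr e.symm, ?_⟩
  have him : Integrable fun ν =>
      ((quot κ ν : ℂ) * amp (quot κ) (initAmp κ x x' (q 0)) v t ν).im := hi.im
  rw [integral_congr_ae e, integral_add him hi2, integral_mul_const]
  congr 1
  exact integral_im hi

theorem quot_sq_ae_eq {κ : ℝ → ℝ} (hκ : ContDiff ℝ 2 κ) (h0 : κ 0 = 0) :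
    (fun ν => κ ν ^ 2 / ν ^ 2) =ᵐ[volume] fun ν => quot κ ν ^ 2 := by
  have : ∀ᵐ ν : ℝ, ν ≠ 0 := Measure.ae_ne volume 0
  filter_upwards [this] with ν hν
  rw [quot_eq_div hκ h0 hν, div_pow]

/-- One power of `ν` is absorbed by `ν a = κ`, so the range of moments ends at `r + 1`, not at `r`.
The intermediate ones follow from `|ν|^i ≤ 1 + |ν|^r` for `i ≤ r`. -/
theorem memLp_pow_mul_quot {κ : ℝ → ℝ} (hκ : ContDiff ℝ 2 κ) (h0 : κ 0 = 0)
    (h : Integrable (deriv (deriv κ))) (h2 : MemLp κ 2 volume) {r : ℕ}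
    (hr : MemLp (fun ν => ν ^ r * κ ν) 2 volume) {i : ℕ} (hi : i ≤ r + 1) :
    MemLp (fun ν => ((ν ^ i * quot κ ν : ℝ) : ℂ)) 2 volume := by
  refine MemLp.ofReal (f := fun ν => ν ^ i * quot κ ν) ?_
  cases i with
  | zero => simpa using memLp_two_quot hκ h0 h h2
  | succ i =>
    have e : ∀ ν : ℝ, ν ^ (i + 1) * quot κ ν = ν ^ i * κ ν := fun ν => by
      rw [← mul_quot hκ h0 ν]; ring
    simp only [e]
    refine (h2.norm.add hr.norm).mono' ?_ (ae_of_all _ fun ν => ?_)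
    · exact (Continuous.mul (by fun_prop) hκ.continuous).aestronglyMeasurable
    · simp only [Pi.add_apply, norm_mul, norm_pow]
      rcases le_total ‖ν‖ 1 with h | h
      · have := mul_le_mul_of_nonneg_right (pow_le_one₀ (n := i) (norm_nonneg ν) h)
          (norm_nonneg (κ ν))
        have : 0 ≤ ‖ν‖ ^ r * ‖κ ν‖ := by positivity
        linarith
      · have := mul_le_mul_of_nonneg_right (pow_le_pow_right₀ h (show i ≤ r by omega))
          (norm_nonneg (κ ν))
        have := norm_nonneg (κ ν)
        linarith

namespace OscNetwork

variable {G : Type*} [Fintype G] (S : OscNetwork G)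

/-- The complex amplitude of the thermostat `m`. -/
def thermAmp (ξ₀ ξ₀' : G → ℝ → ℝ) (q : G → ℝ → ℝ) (m : G) : ℝ → ℝ → ℂ :=
  amp (quot (S.κ m)) (initAmp (S.κ m) (ξ₀ m) (ξ₀' m) (q m 0)) (deriv (q m))

/-- The total energy: kinetic and effective potential energy of the particles, and the energy of
the thermostats measured from their instantaneous equilibria. -/
def totalEnergy (ξ₀ ξ₀' : G → ℝ → ℝ) (q : G → ℝ → ℝ) (t : ℝ) : ℝ :=
  (∑ j, deriv (q j) t ^ 2 / 2) + S.Veff (fun j => q j t) +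
    ∑ m ∈ S.Λ, (∫ ν, ‖S.thermAmp ξ₀ ξ₀' q m t ν‖ ^ 2) / 2

variable {S}

/-- Action and reaction: the two halves of the sum over ordered pairs contribute equally, which
cancels the factor `1/2` of the effective potential. -/
theorem sum_antisymm_mul (W : G → G → ℝ) (hW : ∀ i j, W i j = -W j i) (v : G → ℝ) :
    (1 / 2) * (∑ i, ∑ j, W i j * (v i - v j)) = -∑ j, v j * ∑ i, W i j := by
  have h1 : ∑ i, ∑ j, W i j * v i = -∑ j, v j * ∑ i, W i j := by
    rw [← Finset.sum_neg_distrib]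
    refine Finset.sum_congr rfl fun i _ => ?_
    rw [Finset.mul_sum, ← Finset.sum_neg_distrib]
    refine Finset.sum_congr rfl fun j _ => ?_
    rw [hW i j]; ring
  have h2 : ∑ i, ∑ j, W i j * v j = ∑ j, v j * ∑ i, W i j := by
    rw [Finset.sum_comm]
    refine Finset.sum_congr rfl fun j _ => ?_
    rw [Finset.mul_sum]
    exact Finset.sum_congr rfl fun i _ => mul_comm _ _
  simp only [mul_sub, Finset.sum_sub_distrib]
  rw [h1, h2]
  ring

omit [Fintype G] in
theorem deriv_V_antisymm {i j : G} (h : S.graph.Adj i j) (x : ℝ) :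
    deriv (S.V i j) x = -deriv (S.V j i) (-x) := by
  rw [funext (S.V_symm i j h), deriv_comp_neg]

open Classical in
theorem hasDerivAt_Veff (hA1 : S.A1) {q : G → ℝ → ℝ} {v : G → ℝ} {t : ℝ}
    (hq : ∀ j, HasDerivAt (q j) (v j) t) :
    HasDerivAt (fun t => S.Veff (fun j => q j t))
      ((∑ j, deriv (S.U j) (q j t) * v j)
        - (∑ j, v j * ∑ i ∈ Finset.univ.filter (fun i => S.graph.Adj i j),
            deriv (S.V i j) (q i t - q j t))
        - ∑ m ∈ S.Λ, S.K m * q m t * v m) t := by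
  have h1 : HasDerivAt (fun t => ∑ j, S.U j (q j t)) (∑ j, deriv (S.U j) (q j t) * v j) t :=
    HasDerivAt.fun_sum fun j _ =>
      ((hA1.1 j).differentiable (by simp) (q j t)).hasDerivAt.comp t (hq j)
  have h2 : HasDerivAt (fun t => ∑ i, ∑ j ∈ Finset.univ.filter (fun j => S.graph.Adj i j),
      S.V i j (q i t - q j t))
      (∑ i, ∑ j ∈ Finset.univ.filter (fun j => S.graph.Adj i j),
        deriv (S.V i j) (q i t - q j t) * (v i - v j)) t :=
    HasDerivAt.fun_sum fun i _ => HasDerivAt.fun_sum fun j hj =>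
      (((hA1.2 i j (Finset.mem_filter.1 hj).2).1.differentiable (by simp)
        (q i t - q j t)).hasDerivAt).comp t ((hq i).sub (hq j))
  have h3 : HasDerivAt (fun t => ∑ m ∈ S.Λ, S.K m * q m t ^ 2 / 2)
      (∑ m ∈ S.Λ, S.K m * q m t * v m) t :=
    HasDerivAt.fun_sum fun m _ => by
      refine ((((hq m).pow 2).const_mul (S.K m)).div_const 2).congr_deriv ?_
      push_cast
      ring
  have h4 := (h1.add (h2.const_mul (1 / 2))).sub h3
  -- The pair forces are extended by zero to non-adjacent pairs, so that antisymmetry holds for all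
  -- pairs.
  have e := sum_antisymm_mul
    (fun i j => if S.graph.Adj i j then deriv (S.V i j) (q i t - q j t) else 0)
    (fun i j => by
      by_cases h : S.graph.Adj i j
      · rw [if_pos h, if_pos h.symm, deriv_V_antisymm h, neg_sub]
      · rw [if_neg h, if_neg fun h' => h h'.symm, neg_zero]) v
  simp only [ite_mul, zero_mul, ← Finset.sum_filter] at e
  rw [e, ← sub_eq_add_neg] at h4
  exact h4

section Solution

variable {r : ℕ} {q₀ q₀' : G → ℝ} {ξ₀ ξ₀' : G → ℝ → ℝ} {q : G → ℝ → ℝ} {ξ : G → ℝ → ℝ → ℝ}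

omit [Fintype G] in
theorem A2.map_zero (hA2 : S.A2 r) {m : G} (hm : m ∈ S.Λ) : S.κ m 0 = 0 :=
  ((hA2 m hm).2.1 0).2 rfl

omit [Fintype G] in
theorem A2.integrable_deriv2 (hA2 : S.A2 r) {m : G} (hm : m ∈ S.Λ) :
    Integrable (deriv (deriv (S.κ m))) :=
  memLp_one_iff_integrable.1 (hA2 m hm).2.2.2.2.1

omit [Fintype G] in
theorem A2.integral_quot_sq (hA2 : S.A2 r) {m : G} (hm : m ∈ S.Λ) :
    ∫ ν, quot (S.κ m) ν ^ 2 = S.K m :=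
  (integral_congr_ae (quot_sq_ae_eq (hA2 m hm).1 (hA2.map_zero hm))).symm

theorem IsSolution.hasDerivAt_q (hsol : S.IsSolution q₀ ξ₀ q₀' ξ₀' q ξ) (j : G) (t : ℝ) :
    HasDerivAt (q j) (deriv (q j) t) t :=
  (hsol.differentiable_q j t).hasDerivAt

theorem IsSolution.continuous_deriv (hsol : S.IsSolution q₀ ξ₀ q₀' ξ₀' q ξ) (j : G) :
    Continuous (deriv (q j)) :=
  continuous_iff_continuousAt.2 fun t => (hsol.eq_q j t).continuousAt

theorem IsSolution.ampData (hsol : S.IsSolution q₀ ξ₀ q₀' ξ₀' q ξ) (hA2 : S.A2 r)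
    (hA4 : S.A4 ξ₀ ξ₀') {m : G} (hm : m ∈ S.Λ) :
    AmpData (quot (S.κ m)) (initAmp (S.κ m) (ξ₀ m) (ξ₀' m) (q m 0)) (deriv (q m)) := by
  have hκ := (hA2 m hm).1
  have h2 := memLp_two_quot hκ (hA2.map_zero hm) (hA2.integrable_deriv2 hm) (hA2 m hm).2.2.2.1
  obtain ⟨hx, hx', hE⟩ := hA4 m hm
  obtain ⟨h3, h4⟩ := memLp_of_thermostatEnergy hx hx' hE
  exact ⟨continuous_quot hκ, h2, memLp_initAmp h2 h3 h4 _, hsol.continuous_deriv m⟩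

theorem IsSolution.integrable_and_force_eq (hsol : S.IsSolution q₀ ξ₀ q₀' ξ₀' q ξ) (hA2 : S.A2 r)
    (hA4 : S.A4 ξ₀ ξ₀') {m : G} (hm : m ∈ S.Λ) (t : ℝ) :
    Integrable (fun ν => S.κ m ν * ξ m ν t) ∧ S.force ξ m t =
      (∫ ν, (quot (S.κ m) ν : ℂ) * S.thermAmp ξ₀ ξ₀' q m t ν).im + S.K m * q m t := by
  have := integrable_and_integral_force (hA2 m hm).1 (hA2.map_zero hm) (hsol.ampData hA2 hA4 hm)
    (hsol.hasDerivAt_q m) (hsol.differentiable_ξ m hm) (hsol.eq_ξ m hm) (hsol.init_ξ m hm)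
    (hsol.init_ξ' m hm) t
  rwa [hA2.integral_quot_sq hm] at this

open Classical in
/-- Conservation of energy. -/
theorem IsSolution.totalEnergy_eq (hsol : S.IsSolution q₀ ξ₀ q₀' ξ₀' q ξ) (hA1 : S.A1)
    (hA2 : S.A2 r) (hA4 : S.A4 ξ₀ ξ₀') (t : ℝ) :
    S.totalEnergy ξ₀ ξ₀' q t = S.totalEnergy ξ₀ ξ₀' q 0 := by
  have hd : ∀ t, HasDerivAt (S.totalEnergy ξ₀ ξ₀' q) 0 t := fun t => by
    have h1 : HasDerivAt (fun t => ∑ j, deriv (q j) t ^ 2 / 2) (∑ j, deriv (q j) t *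
        (-deriv (S.U j) (q j t) + (∑ i ∈ Finset.univ.filter (fun i => S.graph.Adj i j),
          deriv (S.V i j) (q i t - q j t)) + (if j ∈ S.Λ then S.force ξ j t else 0))) t := by
      refine HasDerivAt.fun_sum fun j _ => ?_
      refine (((hsol.eq_q j t).pow 2).div_const 2).congr_deriv ?_
      push_cast
      ring
    have h2 := hasDerivAt_Veff hA1 (fun j => hsol.hasDerivAt_q j t)
    have h3 : HasDerivAt (fun t => ∑ m ∈ S.Λ, (∫ ν, ‖S.thermAmp ξ₀ ξ₀' q m t ν‖ ^ 2) / 2)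
        (∑ m ∈ S.Λ, -(deriv (q m) t *
          (∫ ν, (quot (S.κ m) ν : ℂ) * S.thermAmp ξ₀ ξ₀' q m t ν).im)) t := by
      refine HasDerivAt.fun_sum fun m hm => ?_
      refine (((hsol.ampData hA2 hA4 hm).hasDerivAt_energy t).div_const 2).congr_deriv ?_
      rw [thermAmp]
      ring
    refine ((h1.add h2).add h3).congr_deriv ?_
    have e : ∑ j, deriv (q j) t * (if j ∈ S.Λ then S.force ξ j t else 0) =
        ∑ m ∈ S.Λ, deriv (q m) t * S.force ξ m t := by
      simp only [mul_ite, mul_zero, Finset.sum_ite_mem, Finset.univ_inter]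
    -- The power of the thermostat force splits in two: the amplitude part cancels the change of
    -- thermostat energy, and the part `K q q̇` cancels that of the term `-K q²/2` in `V_eff`.
    have e2 : ∑ m ∈ S.Λ, deriv (q m) t * S.force ξ m t = (∑ m ∈ S.Λ, deriv (q m) t *
        (∫ ν, (quot (S.κ m) ν : ℂ) * S.thermAmp ξ₀ ξ₀' q m t ν).im) +
        ∑ m ∈ S.Λ, S.K m * q m t * deriv (q m) t := by
      rw [← Finset.sum_add_distrib]
      refine Finset.sum_congr rfl fun m hm => ?_
      rw [(hsol.integrable_and_force_eq hA2 hA4 hm t).2]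
      ring
    have e3 : ∑ j, deriv (q j) t * -deriv (S.U j) (q j t) =
        -∑ j, deriv (S.U j) (q j t) * deriv (q j) t := by
      rw [← Finset.sum_neg_distrib]
      exact Finset.sum_congr rfl fun j _ => by ring
    simp only [mul_add, Finset.sum_add_distrib, Finset.sum_neg_distrib] at e3 ⊢
    rw [e3, e, e2]
    ring_nf
  exact is_const_of_deriv_eq_zero (fun t => (hd t).differentiableAt) (fun t => (hd t).deriv) t 0

theorem continuous_Veff (hA1 : S.A1) : Continuous S.Veff := by
  classical
  unfold Veff
  refine ((continuous_finsetSum _ fun j _ => ?_).add (continuous_const.mul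
    (continuous_finsetSum _ fun i _ => continuous_finsetSum _ fun j hj => ?_))).sub
    (continuous_finsetSum _ fun m _ => by fun_prop)
  · exact (hA1.1 j).continuous.comp (continuous_apply j)
  · exact (hA1.2 i j (Finset.mem_filter.1 hj).2).1.continuous.comp
      ((continuous_apply i).sub (continuous_apply j))

theorem exists_lowerBound_Veff (hA1 : S.A1) (hA3 : S.A3) : ∃ c, ∀ x, c ≤ S.Veff x := by
  obtain ⟨K, hK, hKs⟩ := mem_cocompact.1 (hA3 (Ici_mem_atTop 0))
  obtain ⟨C, hC⟩ := hK.exists_bound_of_continuousOn (continuous_Veff hA1).continuousOn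
  refine ⟨-|C|, fun x => ?_⟩
  by_cases hx : x ∈ K
  · have := neg_abs_le (S.Veff x)
    have h := hC x hx
    rw [Real.norm_eq_abs] at h
    linarith [le_abs_self C]
  · have : 0 ≤ S.Veff x := hKs hx
    linarith [abs_nonneg C]

theorem exists_bound_of_Veff_le (hA3 : S.A3) (E : ℝ) :
    ∃ Q, ∀ x, S.Veff x ≤ E → ∀ j, |x j| ≤ Q := by
  obtain ⟨K, hK, hKs⟩ := mem_cocompact.1 (hA3 (Ioi_mem_atTop E))
  obtain ⟨C, hC⟩ := hK.isBounded.exists_norm_le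
  refine ⟨C, fun x hx j => ?_⟩
  by_cases hxK : x ∈ K
  · exact (norm_le_pi_norm x j).trans (hC x hxK)
  · exact absurd hx (not_le.2 (hKs hxK))

/-- The a priori bounds. -/
theorem IsSolution.exists_bounds (hsol : S.IsSolution q₀ ξ₀ q₀' ξ₀' q ξ) (hA1 : S.A1)
    (hA2 : S.A2 r) (hA3 : S.A3) (hA4 : S.A4 ξ₀ ξ₀') : ∃ Q D M,
      (∀ j t, |q j t| ≤ Q) ∧ (∀ j t, |deriv (q j) t| ≤ D) ∧
      ∀ m ∈ S.Λ, ∀ t, ∫ ν, ‖S.thermAmp ξ₀ ξ₀' q m t ν‖ ^ 2 ≤ M := by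
  obtain ⟨c, hc⟩ := exists_lowerBound_Veff hA1 hA3
  set E := S.totalEnergy ξ₀ ξ₀' q 0 with hE
  obtain ⟨Q, hQ⟩ := exists_bound_of_Veff_le hA3 E
  have hk : ∀ t, 0 ≤ ∑ j, deriv (q j) t ^ 2 / 2 := fun t =>
    Finset.sum_nonneg fun j _ => by positivity
  have hint : ∀ m t, 0 ≤ (∫ ν, ‖S.thermAmp ξ₀ ξ₀' q m t ν‖ ^ 2) / 2 := fun m t =>
    div_nonneg (integral_nonneg fun ν => by positivity) zero_le_two
  have hth : ∀ t, 0 ≤ ∑ m ∈ S.Λ, (∫ ν, ‖S.thermAmp ξ₀ ξ₀' q m t ν‖ ^ 2) / 2 := fun t =>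
    Finset.sum_nonneg fun m _ => hint m t
  have htot := fun t => hsol.totalEnergy_eq hA1 hA2 hA4 t
  simp only [← hE] at htot
  unfold totalEnergy at htot
  -- With `c` a lower bound of `V_eff`, each nonnegative term of the energy is at most `E - c`. The
  -- velocity bound then uses `2|x| ≤ x² + 1` in place of a square root.
  refine ⟨Q, 2 * (E - c) + 1, 2 * (E - c), fun j t => hQ (fun j => q j t) ?_ j, fun j t => ?_, fun m hm t => ?_⟩
  · linarith [htot t, hk t, hth t]
  · have h1 : deriv (q j) t ^ 2 / 2 ≤ ∑ j, deriv (q j) t ^ 2 / 2 :=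
      Finset.single_le_sum (f := fun j => deriv (q j) t ^ 2 / 2) (fun j _ => by positivity)
        (Finset.mem_univ j)
    have := htot t
    have := hth t
    have := hc fun j => q j t
    rw [← sq_abs] at h1
    nlinarith [sq_nonneg (|deriv (q j) t| - 1)]
  · have h1 := Finset.single_le_sum
      (f := fun m => (∫ ν, ‖S.thermAmp ξ₀ ξ₀' q m t ν‖ ^ 2) / 2) (fun m _ => hint m t) hm
    have := htot t
    have := hk t
    have := hc fun j => q j t
    linarith

end Solution

end OscNetwork

/-- The increment is the integral of the velocity over a window of fixed length. -/
theorem tendsto_sub_of_tendsto_deriv {q v : ℝ → ℝ} (hq : ∀ t, HasDerivAt q (v t) t)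
    (hv : Continuous v) {D : ℝ} (hD : ∀ t, |v t| ≤ D) {l : Filter ℝ} [l.IsCountablyGenerated]
    (hl : ∀ c : ℝ, Tendsto (fun t => t + c) l l) (h0 : Tendsto v l (𝓝 0)) (s : ℝ) :
    Tendsto (fun t => q (t - s) - q t) l (𝓝 0) := by
  have e : ∀ t, q (t - s) - q t = -∫ u in (0 : ℝ)..s, v (t - u) := fun t => by
    rw [intervalIntegral.integral_comp_sub_left, sub_zero,
      intervalIntegral.integral_eq_sub_of_hasDerivAt (fun x _ => hq x) (hv.intervalIntegrable _ _),
      neg_sub]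
  have h1 : Tendsto (fun t => ∫ u in (0 : ℝ)..s, v (t - u)) l (𝓝 (∫ _ in (0 : ℝ)..s, (0 : ℝ))) := by
    refine intervalIntegral.tendsto_integral_filter_of_dominated_convergence (fun _ => D)
      (Eventually.of_forall fun t => ?_)
      (Eventually.of_forall fun t => ae_of_all _ fun u _ => hD _) intervalIntegrable_const
      (ae_of_all _ fun u _ => ?_)
    · exact Continuous.aestronglyMeasurable (by fun_prop)
    · simpa [sub_eq_add_neg, Function.comp_def] using h0.comp (hl (-u))
  rw [funext e]
  simpa using h1.neg

namespace OscNetwork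

variable {G : Type*} [Fintype G] {S : OscNetwork G} {r : ℕ} {q₀ q₀' : G → ℝ} {ξ₀ ξ₀' : G → ℝ → ℝ}
  {q : G → ℝ → ℝ} {ξ : G → ℝ → ℝ → ℝ}

/-- The remainder `φ_m - K_m q_m`. -/
def remainder (S : OscNetwork G) (ξ : G → ℝ → ℝ → ℝ) (q : G → ℝ → ℝ) (m : G) (t : ℝ) : ℝ :=
  S.force ξ m t - S.K m * q m t

theorem IsSolution.remainder_eq (hsol : S.IsSolution q₀ ξ₀ q₀' ξ₀' q ξ) (hA2 : S.A2 r)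
    (hA4 : S.A4 ξ₀ ξ₀') {m : G} (hm : m ∈ S.Λ) :
    S.remainder ξ q m = fun t => Complex.imCLM
      (∫ ν, (quot (S.κ m) ν : ℂ) * S.thermAmp ξ₀ ξ₀' q m t ν) := by
  funext t
  rw [remainder, (hsol.integrable_and_force_eq hA2 hA4 hm t).2, add_sub_cancel_right]
  rfl

theorem IsSolution.cbReg_remainder (hsol : S.IsSolution q₀ ξ₀ q₀' ξ₀' q ξ) (hA2 : S.A2 r)
    (hA4 : S.A4 ξ₀ ξ₀') {m : G} (hm : m ∈ S.Λ) {D M : ℝ} (hD : ∀ t, |deriv (q m) t| ≤ D)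
    (hM : ∀ t, ∫ ν, ‖S.thermAmp ξ₀ ξ₀' q m t ν‖ ^ 2 ≤ M) {n : ℕ} (hn : n ≤ r + 1)
    (hv : CbReg (n - 1) (deriv (q m))) : CbReg n (S.remainder ξ q m) := by
  obtain ⟨hκ, -, -, h2, -, -, hr, -⟩ := hA2 m hm
  have key := (hsol.ampData hA2 hA4 hm).cbReg_functional hM hD
    (c := fun i ν => ((ν ^ i * quot (S.κ m) ν : ℝ) : ℂ)) (R := r + 1)
    (fun i hi => memLp_pow_mul_quot hκ (hA2.map_zero hm) (hA2.integrable_deriv2 hm) h2 hr hi)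
    (fun i ν => by push_cast; ring) (n := n) (i := 0) (by omega) hv
  rw [hsol.remainder_eq hA2 hA4 hm]
  simp only [pow_zero, one_mul] at key
  exact key.clm Complex.imCLM

open Classical in
theorem IsSolution.cbReg_acceleration (hsol : S.IsSolution q₀ ξ₀ q₀' ξ₀' q ξ) (hA1 : S.A1) {n : ℕ}
    (hq : ∀ j, CbReg n (q j)) (hθ : ∀ m ∈ S.Λ, CbReg n (S.remainder ξ q m)) (j : G) :
    ∃ F : ℝ → ℝ, (∀ t, HasDerivAt (deriv (q j)) (F t) t) ∧ CbReg n F := by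
  refine ⟨_, hsol.eq_q j, ?_⟩
  have hneg : ∀ {f : ℝ → ℝ}, CbReg n f → CbReg n (fun t => -f t) := fun hf => by
    simpa using hf.clm (-ContinuousLinearMap.id ℝ ℝ)
  have hU : CbReg n (fun t => deriv (S.U j) (q j t)) :=
    (hq j).comp_contDiff (contDiff_infty_iff_deriv.1 (hA1.1 j)).2
  have hV : CbReg n (fun t => ∑ i ∈ Finset.univ.filter (fun i => S.graph.Adj i j),
      deriv (S.V i j) (q i t - q j t)) :=
    CbReg.sum _ fun i hi => by
      have h1 := (hq i).add (hneg (hq j))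
      simp only [← sub_eq_add_neg] at h1
      exact h1.comp_contDiff
        (contDiff_infty_iff_deriv.1 (hA1.2 i j (Finset.mem_filter.1 hi).2).1).2
  have hf : CbReg n (fun t => if j ∈ S.Λ then S.force ξ j t else 0) := by
    by_cases hj : j ∈ S.Λ
    · simp only [if_pos hj]
      have := (hθ j hj).add ((hq j).clm (ContinuousLinearMap.mul ℝ ℝ (S.K j)))
      simpa [remainder] using this
    · simp only [if_neg hj]
      exact CbReg.zero n
  exact ((hneg hU).add hV).add hf

/-- Newton's equation turns order `n` of all `q` and all remainders into order `n + 2` of `q`. Order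
`n + 1` of the remainder asks for order `n` of `q̇`, which is then available with one to spare; only
the supply of moments stops the induction at `r + 1`. -/
theorem IsSolution.cbReg (hsol : S.IsSolution q₀ ξ₀ q₀' ξ₀' q ξ) (hA1 : S.A1)
    (hA2 : S.A2 r) (hA3 : S.A3) (hA4 : S.A4 ξ₀ ξ₀') {n : ℕ} (hn : n ≤ r + 1) :
    (∀ j, CbReg (n + 2) (q j)) ∧ ∀ m ∈ S.Λ, CbReg n (S.remainder ξ q m) := by
  obtain ⟨Q, D, M, hQ, hD, hM⟩ := hsol.exists_bounds hA1 hA2 hA3 hA4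
  have hCq : ∀ j, q j ∈ Cb ℝ := fun j => Cb.of_hasDerivAt (hsol.hasDerivAt_q j) (hQ j) (hD j)
  have step : ∀ n, (∀ j, CbReg n (q j)) → (∀ m ∈ S.Λ, CbReg n (S.remainder ξ q m)) →
      ∀ j, CbReg (n + 2) (q j) := fun n hq hθ j => by
    obtain ⟨F, hF, hFr⟩ := hsol.cbReg_acceleration hA1 hq hθ j
    obtain ⟨C, hC⟩ := hFr.mem_Cb.2
    exact CbReg.of_hasDerivAt (hCq j) (hsol.hasDerivAt_q j)
      (CbReg.of_hasDerivAt (Cb.of_hasDerivAt hF (hD j) hC) hF hFr)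
  induction n with
  | zero =>
    have hθ : ∀ m ∈ S.Λ, CbReg 0 (S.remainder ξ q m) := fun m hm => by
      have h := (hsol.ampData hA2 hA4 hm).functional_mem_Cb
        (hsol.ampData hA2 hA4 hm).memLp_a.ofReal (hM m hm) (hD m)
      rw [hsol.remainder_eq hA2 hA4 hm]
      exact Cb.clm Complex.imCLM h
    exact ⟨step 0 hCq hθ, hθ⟩
  | succ n ih =>
    have hq := (ih (by omega)).1
    have hθ : ∀ m ∈ S.Λ, CbReg (n + 1) (S.remainder ξ q m) := fun m hm =>
      hsol.cbReg_remainder hA2 hA4 hm (hD m) (hM m hm) hn ((hq m).2.2.mono (by omega))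
    exact ⟨step (n + 1) (fun j => (hq j).mono (by omega)) hθ, hθ⟩

theorem IsSolution.tendsto_velocity (hsol : S.IsSolution q₀ ξ₀ q₀' ξ₀' q ξ) (hA1 : S.A1)
    (hA2 : S.A2 r) (hA3 : S.A3) (hA4 : S.A4 ξ₀ ξ₀') {m : G} (hm : m ∈ S.Λ)
    {l : Filter ℝ} [l.IsCountablyGenerated] (hl : l ≤ cocompact ℝ) :
    Tendsto (deriv (q m)) l (𝓝 0) := by
  obtain ⟨Q, D, M, hQ, hD, hM⟩ := hsol.exists_bounds hA1 hA2 hA3 hA4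
  -- The lowest level of the bootstrap already bounds `q̈`, which supplies the Lipschitz constant of
  -- the velocity.
  have hreg := (hsol.cbReg hA1 hA2 hA3 hA4 (Nat.zero_le _)).1 m
  obtain ⟨L, hL⟩ := hreg.2.2.2.2.2
  refine (hsol.ampData hA2 hA4 hm).tendsto_velocity (hM m hm) (hD m) (L := L) (fun s t => ?_)
    (hsol.hasDerivAt_q m) (hQ m) (fun ν hν h0 => ?_) hl
  · exact Convex.norm_image_sub_le_of_norm_deriv_le (𝕜 := ℝ) (s := Set.univ)
      (fun x _ => hreg.2.2.2.1 x) (fun x _ => hL x) convex_univ (Set.mem_univ t) (Set.mem_univ s)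
  · obtain ⟨hκ, hz, -⟩ := hA2 m hm
    refine hν ((hz ν).1 ?_)
    rw [← mul_quot hκ (hA2.map_zero hm), h0, mul_zero]

theorem IsSolution.tendsto_remainder (hsol : S.IsSolution q₀ ξ₀ q₀' ξ₀' q ξ) (hA1 : S.A1)
    (hA2 : S.A2 r) (hA3 : S.A3) (hA4 : S.A4 ξ₀ ξ₀') {m : G} (hm : m ∈ S.Λ)
    {l : Filter ℝ} [l.IsCountablyGenerated] (hl : l ≤ cocompact ℝ)
    (hl' : ∀ c : ℝ, Tendsto (fun t => t + c) l l) :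
    Tendsto (S.remainder ξ q m) l (𝓝 0) := by
  obtain ⟨Q, D, M, hQ, hD, hM⟩ := hsol.exists_bounds hA1 hA2 hA3 hA4
  obtain ⟨hκ, -, -, h2, -⟩ := hA2 m hm
  have := (hsol.ampData hA2 hA4 hm).tendsto_functional (hD m)
    (integrable_oscInt_quot_sq hκ (hA2.map_zero hm) (hA2.integrable_deriv2 hm) h2) hl hl'
    (hsol.tendsto_velocity hA1 hA2 hA3 hA4 hm hl)
  rw [hsol.remainder_eq hA2 hA4 hm]
  simpa using! (Complex.continuous_im.tendsto 0).comp this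

end OscNetwork


end

theorem mainTheorem3 {G : Type*} [Fintype G] (S : OscNetwork G) (r : ℕ)
    (q₀ q₀' : G → ℝ) (ξ₀ ξ₀' : G → ℝ → ℝ)
    (hA1 : S.A1) (hA2 : S.A2 r) (hA3 : S.A3) (hA4 : S.A4 ξ₀ ξ₀')
    (q : G → ℝ → ℝ) (ξ : G → ℝ → ℝ → ℝ) (hsol : S.IsSolution q₀ ξ₀ q₀' ξ₀' q ξ) :
    -- the integrals that define `K_m` and `φ_m` converge
    (∀ m ∈ S.Λ, Integrable (fun ν : ℝ => S.κ m ν ^ 2 / ν ^ 2) ∧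
      ∀ t, Integrable (fun ν : ℝ => S.κ m ν * ξ m ν t)) ∧
    -- the singular support of `q̂_m`
    (∀ m ∈ S.Λ, (fun t => (q m t : ℂ)) ∈ Cb ℂ ∧ ssuppHat (fun t => (q m t : ℂ)) ⊆ {0}) ∧
    -- smoothness of `φ_m` and of all `q_j`
    (∀ m ∈ S.Λ, ContDiff ℝ ((r + 1 : ℕ) : WithTop ℕ∞) (S.force ξ m) ∧
      ∀ k ≤ r + 1, iteratedDeriv k (S.force ξ m) ∈ Cb ℝ) ∧
    (∀ j, ContDiff ℝ ((r + 3 : ℕ) : WithTop ℕ∞) (q j) ∧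
      ∀ k ≤ r + 3, iteratedDeriv k (q j) ∈ Cb ℝ) ∧
    -- the remainder `θ_m = φ_m - K_m q_m`
    (∀ m ∈ S.Λ,
      ContDiff ℝ ((r + 1 : ℕ) : WithTop ℕ∞) (fun t => S.force ξ m t - S.K m * q m t) ∧
      ∀ k ≤ r + 1,
        iteratedDeriv k (fun t => S.force ξ m t - S.K m * q m t) ∈ C0 ℝ) := by
  obtain ⟨hq, hθ⟩ := hsol.cbReg hA1 hA2 hA3 hA4 le_rfl
  obtain ⟨Q, D, M, hQ, hD, hM⟩ := hsol.exists_bounds hA1 hA2 hA3 hA4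
  have hT : ∀ c : ℝ, Tendsto (fun t => t + c) atTop atTop := fun c =>
    tendsto_atTop_add_const_right _ c tendsto_id
  have hB : ∀ c : ℝ, Tendsto (fun t => t + c) atBot atBot := fun c =>
    tendsto_atBot_add_const_right _ c tendsto_id
  -- The force is `θ + K q`, so its order is limited by that of the remainder.
  have hφ : ∀ m ∈ S.Λ, CbReg (r + 1) (S.force ξ m) := fun m hm => by
    have := (hθ m hm).add
      (((hq m).mono (by omega : r + 1 ≤ _)).clm (ContinuousLinearMap.mul ℝ ℝ (S.K m)))
    simpa [OscNetwork.remainder] using this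
  refine ⟨fun m hm => ⟨?_, fun t => (hsol.integrable_and_force_eq hA2 hA4 hm t).1⟩,
    fun m hm => ?_, fun m hm => ⟨(hφ m hm).contDiff, fun k hk => ((hφ m hm).iteratedDeriv hk).mem_Cb⟩,
    fun j => ⟨(hq j).contDiff, fun k hk => ((hq j).iteratedDeriv hk).mem_Cb⟩,
    fun m hm => ⟨(hθ m hm).contDiff, fun k hk => (hθ m hm).iteratedDeriv_mem_C0 hk
      (hsol.tendsto_remainder hA1 hA2 hA3 hA4 hm atTop_le_cocompact hT)
      (hsol.tendsto_remainder hA1 hA2 hA3 hA4 hm atBot_le_cocompact hB)⟩⟩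
  · exact (hsol.ampData hA2 hA4 hm).memLp_a.integrable_sq.congr
      (quot_sq_ae_eq (hA2 m hm).1 (hA2.map_zero hm)).symm
  · have hC : (fun t => (q m t : ℂ)) ∈ Cb ℂ := Cb.clm Complex.ofRealCLM (hq m).mem_Cb
    have hs : ∀ {l : Filter ℝ} [l.IsCountablyGenerated], l ≤ cocompact ℝ →
        (∀ c : ℝ, Tendsto (fun t => t + c) l l) → ∀ s : ℝ,
        Tendsto (fun t => (q m (t - s) : ℂ) - (q m t : ℂ)) l (𝓝 0) := fun hl hl' s => by
      have := tendsto_sub_of_tendsto_deriv (hsol.hasDerivAt_q m) (hsol.continuous_deriv m) (hD m)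
        hl' (hsol.tendsto_velocity hA1 hA2 hA3 hA4 hm hl) s
      simpa [Function.comp_def] using (Complex.continuous_ofReal.tendsto 0).comp this
    exact ⟨hC, ssuppHat_subset_zero hC (hs atTop_le_cocompact hT) (hs atBot_le_cocompact hB)⟩
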